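/- A simplicial complex $\Gamma$ on a finite vertex set $V$, $|V|=n$, is a collection of subsets of $V$ (its faces), containing $\emptyset$ and closed under taking subsets (a vertex need not itself be a face). Its dimension is one less than the maximum cardinality of a face, and $f_i(\Gamma)$ is the number of faces with $i+1$ vertices. For $W\subseteq V$ let $\Gamma[W]=\{F\in\Gamma: F\subseteq W\}$, and for $F\in\Gamma$ let $\mathrm{lk}_\Gamma(F)=\{G\setminus F : F\subseteq G\in\Gamma\}$, a complex on $V\setminus F$. For a field $\mathbf k$, the $1$-girth of $\Gamma$ is $$\mathrm{gr}_1(\Gamma)=\min\{|W| : W\subseteq V\setminus F,\ \tilde H_1(\mathrm{lk}_\Gamma(F)[W];\mathbf k)\neq 0\ \text{for some (possibly empty) face } F\in\Gamma\},$$ where $\tilde H_1$ is reduced simplicial homology, and $\mathrm{gr}_1(\Gamma)=\infty$ if there is no such $W$. Theorem. For every $\epsilon>0$ there exists $\delta>0$, depending only on $\epsilon$, such that the following holds for every field $\mathbf k$, all integers $r\ge 2$ and $1\le d<n$, and every $(d-1)$-dimensional simplicial complex $\Gamma$ with $n$ vertices. Suppose that $r/\log(n/d)<\delta$. If $\mathrm{gr}_1(\Gamma)>2r$,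 then $$f_1(\Gamma)\le\left(\tfrac12+\epsilon\right)(d-1)^{1-1/r}\,n^{1+1/r}.$$ If moreover $\mathrm{gr}_1(\Gamma)>2r+1$, then $$f_1(\Gamma)\le\left(2^{-1-1/r}+\epsilon\right)(d-1)^{1-1/r}\,n^{1+1/r}.$$ -/

import Mathlib

namespace PreAbstractSimplicialComplex

section Complexes

variable {V : Type*}

/-- `F` is a face of `K`, where (as usual in combinatorics) the empty set also counts as a face.
Mathlib's `PreAbstractSimplicialComplex` stores only the nonempty faces. -/
def IsFace (K : PreAbstractSimplicialComplex V) (F : Finset V) : Prop :=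
  F = ∅ ∨ F ∈ K.faces

theorem IsFace.mono {K : PreAbstractSimplicialComplex V} {F G : Finset V}
    (hF : K.IsFace F) (h : G ⊆ F) : K.IsFace G := by
  rcases G.eq_empty_or_nonempty with hG | hG
  · exact Or.inl hG
  · rcases hF with rfl | hF
    · exact Or.inl (Finset.subset_empty.mp h)
    · exact Or.inr ((K.isRelLowerSet_faces hF).2 h hG)

/-- `K` has dimension `e`: the maximum of `|F| - 1` over all faces `F` is `e`. -/
def HasDimension (K : PreAbstractSimplicialComplex V) (e : ℤ) : Prop :=
  IsGreatest {j : ℤ | ∃ F : Finset V, K.IsFace F ∧ j = (F.card : ℤ) - 1} e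

/-- The face number `f_i(K)`: the number of faces with `i + 1` vertices. -/
noncomputable def faceNumber (K : PreAbstractSimplicialComplex V) (i : ℕ) : ℕ :=
  Set.ncard {F : Finset V | F ∈ K.faces ∧ F.card = i + 1}

/-- The induced subcomplex `K[W]`. -/
def induced (K : PreAbstractSimplicialComplex V) (W : Finset V) :
    PreAbstractSimplicialComplex V where
  faces := {F | F ∈ K.faces ∧ F ⊆ W}
  isRelLowerSet_faces := fun {_} ⟨hF, hW⟩ =>
    ⟨(K.isRelLowerSet_faces hF).1, fun _ hGF hG =>
      ⟨(K.isRelLowerSet_faces hF).2 hGF hG, hGF.trans hW⟩⟩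

variable [DecidableEq V] in
/-- The link `lk_K(F)`: its faces are the sets `G` disjoint from `F` with `G ∪ F` a face of `K`,
i.e. the sets `H \ F` for faces `H ⊇ F` of `K`. -/
def link (K : PreAbstractSimplicialComplex V) (F : Finset V) :
    PreAbstractSimplicialComplex V where
  faces := {G | G.Nonempty ∧ Disjoint G F ∧ G ∪ F ∈ K.faces}
  isRelLowerSet_faces := fun {_} ⟨hG, hd, hm⟩ =>
    ⟨hG, fun _ hHG hH => ⟨hH, hd.mono_left hHG, (K.isRelLowerSet_faces hm).2
      (Finset.union_subset_union_left hHG) (hH.mono Finset.subset_union_left)⟩⟩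

end Complexes

section Homology

variable {V : Type*} [DecidableEq V] (K : PreAbstractSimplicialComplex V)
variable (k : Type*) [Field k]

/-- The space of oriented simplicial chains of `K` on faces with `m` vertices (that is, chains of
dimension `m - 1`), with coefficients in `k`. A chain assigns a coefficient to every ordered
simplex `(v₀, …, v_{m-1})` of `K`; it changes by the sign of `σ` when the vertices are permuted by
`σ`, and it is zero on tuples which have a repeated vertex or whose vertices do not form a face.
For `m = 0` this is the one-dimensional space spanned by the empty face. -/
def chains (m : ℕ) : Submodule k ((Fin m → V) → k) where
  carrier := {c | (∀ v, c v ≠ 0 → Function.Injective v ∧ K.IsFace (Finset.univ.image v)) ∧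
    ∀ (σ : Equiv.Perm (Fin m)) (v : Fin m → V), c (v ∘ σ) = ((Equiv.Perm.sign σ : ℤ) : k) * c v}
  add_mem' := by
    rintro a b ⟨ha, ha'⟩ ⟨hb, hb'⟩
    refine ⟨fun v hv => ?_, fun σ v => by simp [ha', hb', mul_add]⟩
    by_cases h : a v = 0
    · exact hb v (fun h' => hv (by simp [h, h']))
    · exact ha v h
  zero_mem' := ⟨fun v hv => absurd rfl hv, fun σ v => by simp⟩
  smul_mem' := by
    rintro t a ⟨ha, ha'⟩
    refine ⟨fun v hv => ha v (fun h => hv (by simp [h])), fun σ v => ?_⟩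
    simp only [Pi.smul_apply, smul_eq_mul, ha']
    ring

variable [Fintype V]

variable (V) in
/-- The simplicial boundary map on coefficient functions (for `m = 0` it is the augmentation). As
`∂[v₀, …, v_m] = ∑ i, (-1)^i [v₀, …, v̂_i, …, v_m]`, the coefficient of `∂ c` at the ordered simplex
`(u₀, …, u_{m-1})` is the sum of the coefficients of `c` at `(v, u₀, …, u_{m-1})` over all `v`. -/
def boundaryMap (m : ℕ) : ((Fin (m + 1) → V) → k) →ₗ[k] ((Fin m → V) → k) where
  toFun c := fun u => ∑ v : V, c (Fin.cons v u)
  map_add' a b := by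
    ext u
    simp [Finset.sum_add_distrib]
  map_smul' t a := by
    ext u
    simp [Finset.mul_sum]

/-- The `i`-cycles of `K`, where for `i = 0` the augmentation has to vanish. -/
def cycles (i : ℕ) : Submodule k ((Fin (i + 1) → V) → k) :=
  K.chains k (i + 1) ⊓ LinearMap.ker (boundaryMap V k i)

/-- The `i`-boundaries of `K`. -/
def boundaries (i : ℕ) : Submodule k ((Fin (i + 1) → V) → k) :=
  (K.chains k (i + 2)).map (boundaryMap V k (i + 1))

variable {k} in
theorem boundaryMap_mem_chains (m : ℕ) {c : (Fin (m + 1) → V) → k}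
    (h : c ∈ K.chains k (m + 1)) : boundaryMap V k m c ∈ K.chains k m := by
  obtain ⟨hc, hc'⟩ := h
  refine ⟨fun u hu => ?_, fun σ u => ?_⟩
  · obtain ⟨v, -, hv⟩ := Finset.exists_ne_zero_of_sum_ne_zero hu
    obtain ⟨h1, h2⟩ := hc _ hv
    refine ⟨(Fin.cons_injective_iff.mp h1).2, h2.mono ?_⟩
    intro x hx
    obtain ⟨i, -, rfl⟩ := Finset.mem_image.mp hx
    exact Finset.mem_image.mpr ⟨i.succ, Finset.mem_univ _, by simp⟩
  · change ∑ v : V, c (Fin.cons v (u ∘ σ)) = _ * ∑ v : V, c (Fin.cons v u)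
    simp only [Finset.mul_sum]
    refine Finset.sum_congr rfl fun v _ => ?_
    have h := hc' (Equiv.Perm.decomposeFin.symm (0, σ)) (Fin.cons v u)
    rw [Equiv.Perm.decomposeFin.symm_sign] at h
    simp only [if_true, one_mul] at h
    rw [← h]
    congr 1
    funext i
    refine Fin.cases ?_ (fun j => ?_) i
    · simp
    · simp

/-- Every boundary is a cycle. -/
theorem boundaries_le_cycles (i : ℕ) : K.boundaries k i ≤ K.cycles k i := by
  rintro _ ⟨c, hmem, rfl⟩
  refine ⟨K.boundaryMap_mem_chains _ hmem, ?_⟩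
  obtain ⟨hc, hc'⟩ := hmem
  rw [SetLike.mem_coe, LinearMap.mem_ker]
  ext u
  change ∑ w : V, ∑ v : V, c (Fin.cons v (Fin.cons w u)) = 0
  rw [← Finset.sum_product']
  refine Finset.sum_involution (fun p _ => (p.2, p.1)) ?_ ?_ (by simp) (by simp)
  · rintro ⟨w, v⟩ -
    have h := hc' (Equiv.swap 0 1) (Fin.cons v (Fin.cons w u))
    rw [Equiv.Perm.sign_swap (by simp)] at h
    have e : (Fin.cons v (Fin.cons w u) : Fin (i + 2) → V) ∘ (Equiv.swap 0 1 : Equiv.Perm _)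
        = Fin.cons w (Fin.cons v u) := by
      funext x
      refine Fin.cases ?_ (fun j => Fin.cases ?_ (fun l => ?_) j) x
      · simp only [Function.comp, Equiv.swap_apply_left]; rfl
      · change (Fin.cons v (Fin.cons w u) : Fin (i + 2) → V) (Equiv.swap 0 1 1) = _
        simp only [Equiv.swap_apply_right]; rfl
      · have hl : (Equiv.swap 0 1 : Equiv.Perm (Fin (i + 2))) l.succ.succ = l.succ.succ :=
          Equiv.swap_apply_of_ne_of_ne (Fin.succ_ne_zero _)
            (fun h => Fin.succ_ne_zero l (Fin.succ_injective _ h))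
        simp only [Function.comp, hl]
        rfl
    rw [e] at h
    simp only [h]
    simp
  · rintro ⟨w, v⟩ - hne heq
    have hvw : v = w := (Prod.mk.inj heq).1
    subst hvw
    have := (hc _ hne).1 (a₁ := 0) (a₂ := 1) rfl
    simp at this

/-- The reduced simplicial homology `H̃_i(K; k)`, `i ≥ 0`: cycles modulo boundaries. -/
abbrev ReducedHomology (i : ℕ) : Type _ :=
  K.cycles k i ⧸ (K.boundaries k i).submoduleOf (K.cycles k i)

/-- The `i`-girth `gr_i(K)`: the least `|W|` such that `H̃_i(lk_K(F)[W]; k) ≠ 0` for some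
(possibly empty) face `F` of `K`, with `W` a set of vertices of the link, or `∞` if there is
no such `W`. -/
noncomputable def girth (i : ℕ) : ℕ∞ :=
  sInf {g : ℕ∞ | ∃ F W : Finset V, K.IsFace F ∧ Disjoint W F ∧
    Nontrivial (((K.link F).induced W).ReducedHomology k i) ∧ g = (W.card : ℕ∞)}

end Homology

end PreAbstractSimplicialComplex

/-!
Let `G` be the graph of the edges of `Γ`. Two walks in a link with the same end points form a
cycle, and a cycle that runs along an edge contained in no triangle of the complex is not a
boundary (`girth_one_le_of_walks`). So a lower bound on the `1`-girth makes `Γ` a flag complex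
(`isFace_of_isClique`), whence cliques of `G` have at most `d` vertices, and it makes every set of
at most `2 r` vertices, or `2 r + 1` vertices, behave like a chordal graph
(`ShortCyclesHaveTriangles`).

As in the Moore bound, one counts walks. In place of non-backtracking walks one takes the walks in
which any three consecutive vertices induce a path. If they are short, such walks are induced
paths, and those with given end points have pairwise equal or adjacent first inner vertices
(`IsLocallyInduced.first_eq_or_adj`). These form a clique with the starting point, so that at most
`(d - 1) ^ (r - 1)` walks of length `r` join two given vertices. Hence a directed edge has at most
`n (d - 1) ^ (r - 1)` extensions by `r` steps; if the girth exceeds `2 r + 1`, the same bound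
holds for the extensions of an edge in both directions together, because their end points differ.

For the lower bound, `G` is thinned out to a subgraph `H` with almost as many edges, in which for
each edge `uv` only a small proportion `θ` of the neighbours of `v` are adjacent to `u` in `G`
(`exists_subgraph_few_triangles`). This is possible because two nonadjacent vertices have at most
`d` common neighbours; the error is `O(n d)`. At each vertex `v` of `H` there is a symmetric
doubly stochastic matrix on the neighbours of `v`, supported on the nonadjacent pairs, with
entries at most `1 / ((1 - 2 θ) deg v)` (`exists_doubly_stochastic`). The resulting random walk on
directed edges preserves the uniform distribution, and its entropy shows that the extensions by
`r` steps have geometric mean at least `((1 - 2 θ) a) ^ r`, where `a` is the average degree of `H`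
(`pow_average_degree_le`). So `a` is at most about `(n (d - 1) ^ (r - 1)) ^ (1 / r)`, or
`(n (d - 1) ^ (r - 1) / 2) ^ (1 / r)` in the second case. The hypothesis on `r / log (n / d)` says
that `(n / d) ^ (1 / r)` is large, which makes the error `O(n d)` negligible.
-/

/-! ### Homology of the links and the graph of edges -/

namespace PreAbstractSimplicialComplex

section Theta

variable {V : Type*} [DecidableEq V] (k : Type*) [Field k]

/-- The oriented simplicial `1`-chain of the walk `P 0, P 1, …, P p`. -/
def walkChain (P : ℕ → V) (p : ℕ) : (Fin 2 → V) → k := fun v =>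
  ∑ i ∈ Finset.range p, ((if v 0 = P i ∧ v 1 = P (i + 1) then 1 else 0) -
    (if v 0 = P (i + 1) ∧ v 1 = P i then 1 else 0))

theorem walkChain_mem_chains (K : PreAbstractSimplicialComplex V) {P : ℕ → V} {p : ℕ}
    (h : ∀ i < p, P i ≠ P (i + 1) ∧ {P i, P (i + 1)} ∈ K.faces) :
    walkChain k P p ∈ K.chains k 2 := by
  have himg : ∀ v : Fin 2 → V, Finset.univ.image v = {v 0, v 1} := by
    intro v
    ext x
    simp [Fin.exists_fin_two, eq_comm]
  refine ⟨fun v hv => ?_, fun σ v => ?_⟩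
  · obtain ⟨i, hi, hne⟩ := Finset.exists_ne_zero_of_sum_ne_zero hv
    obtain ⟨h1, h2⟩ := h i (Finset.mem_range.1 hi)
    have : v 0 ≠ v 1 ∧ ({v 0, v 1} : Finset V) ∈ K.faces := by
      by_cases ha : v 0 = P i ∧ v 1 = P (i + 1)
      · rw [ha.1, ha.2]; exact ⟨h1, h2⟩
      · by_cases hb : v 0 = P (i + 1) ∧ v 1 = P i
        · rw [hb.1, hb.2, Finset.pair_comm]; exact ⟨h1.symm, h2⟩
        · simp [ha, hb] at hne
    refine ⟨?_, ?_⟩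
    · intro a b hab
      fin_cases a <;> fin_cases b <;> simp_all [this.1.symm]
    · rw [himg]; exact Or.inr this.2
  · have hσ : σ = 1 ∨ σ = Equiv.swap 0 1 := by
      revert σ; decide
    rcases hσ with rfl | rfl
    · simp
    · rw [Equiv.Perm.sign_swap (by decide)]
      simp only [walkChain, Function.comp, Equiv.swap_apply_left, Equiv.swap_apply_right]
      rw [Finset.mul_sum]
      refine Finset.sum_congr rfl fun i _ => ?_
      simp only [and_comm (a := v 1 = _)]
      push_cast
      ring

theorem boundaryMap_walkChain [Fintype V] (P : ℕ → V) (p : ℕ) (u : Fin 1 → V) :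
    boundaryMap V k 1 (walkChain k P p) u =
      (if u 0 = P p then 1 else 0) - (if u 0 = P 0 then 1 else 0) := by
  change ∑ v : V, walkChain k P p (Fin.cons v u) = _
  have h1 : ∀ v : V, (Fin.cons v u : Fin 2 → V) 1 = u 0 := fun v => rfl
  simp only [walkChain, Fin.cons_zero, h1]
  rw [Finset.sum_comm, ← Finset.sum_range_sub (fun i => if u 0 = P i then (1 : k) else 0)]
  refine Finset.sum_congr rfl fun i _ => ?_
  rw [Finset.sum_sub_distrib]
  simp [ite_and, Finset.sum_ite_eq']

variable [Fintype V]

variable {k} in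
/-- A cycle which has a nonzero coefficient at an edge contained in no triangle of `K` is not a
boundary. -/
theorem nontrivial_reducedHomology_one (K : PreAbstractSimplicialComplex V)
    {c : (Fin 2 → V) → k} (hc : c ∈ K.cycles k 1) {u x : V} (hne : c (Fin.cons u fun _ => x) ≠ 0)
    (h : ∀ y, y ≠ u → y ≠ x → {y, u, x} ∉ K.faces) : Nontrivial (K.ReducedHomology k 1) := by
  rw [Submodule.Quotient.nontrivial_iff]
  intro htop
  have hmem : (⟨c, hc⟩ : K.cycles k 1) ∈ (K.boundaries k 1).submoduleOf (K.cycles k 1) := by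
    rw [htop]; trivial
  obtain ⟨b, ⟨hb, -⟩, hbc⟩ := hmem
  apply hne
  have : c = boundaryMap V k 2 b := hbc.symm
  rw [this]
  refine Finset.sum_eq_zero fun y _ => ?_
  by_contra hy
  obtain ⟨hinj, hface⟩ := hb _ hy
  have himg : Finset.univ.image (Fin.cons y (Fin.cons u fun _ => x : Fin 2 → V) : Fin 3 → V)
      = {y, u, x} := by
    ext z
    simp [Fin.exists_fin_succ, eq_comm]
  rw [himg] at hface
  refine h y ?_ ?_ (hface.resolve_left (by simp))
  · intro e
    have := hinj (a₁ := 0) (a₂ := 1) e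
    simp at this
  · intro e
    have := hinj (a₁ := 0) (a₂ := 2) e
    simp at this

/-- Two walks from `P 0 = Q 0` to `P p = Q q` in the link of a face form a cycle. If it leaves its
starting point along an edge that lies in no triangle with a third vertex of the two walks, then
this cycle is not a boundary, and the girth is at most the number `p + q` of its vertices. -/
theorem girth_one_le_of_walks (Γ : PreAbstractSimplicialComplex V) {F : Finset V}
    (hF : Γ.IsFace F) {P Q : ℕ → V} {p q : ℕ} (hp : 1 ≤ p) (hq : 1 ≤ q) (h0 : P 0 = Q 0)
    (h1 : P p = Q q)
    (hP : ∀ i < p, P i ≠ P (i + 1) ∧ {P i, P (i + 1)} ∈ (Γ.link F).faces)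
    (hQ : ∀ i < q, Q i ≠ Q (i + 1) ∧ {Q i, Q (i + 1)} ∈ (Γ.link F).faces)
    (hP0 : ∀ i, 1 ≤ i → i ≤ p → P i ≠ P 0) (hQ0 : ∀ i, 1 ≤ i → i ≤ q → Q i ≠ Q 0)
    (hne : P 1 ≠ Q 1)
    (hno : ∀ y, ((∃ i ≤ p, P i = y) ∨ ∃ i ≤ q, Q i = y) → y ≠ P 0 → y ≠ P 1 →
      {y, P 0, P 1} ∉ (Γ.link F).faces) :
    Γ.girth k 1 ≤ ((p + q : ℕ) : ℕ∞) := by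
  set W : Finset V := (Finset.range (p + 1)).image P ∪ (Finset.Ico 1 q).image Q with hW
  have hPW : ∀ i ≤ p, P i ∈ W := fun i hi =>
    Finset.mem_union_left _ (Finset.mem_image_of_mem _ (Finset.mem_range.2 (by omega)))
  have hQW : ∀ i ≤ q, Q i ∈ W := by
    intro i hi
    rcases Nat.eq_zero_or_pos i with rfl | hi0
    · rw [← h0]; exact hPW 0 (by omega)
    rcases hi.eq_or_lt with rfl | hlt
    · rw [← h1]; exact hPW p le_rfl
    · exact Finset.mem_union_right _ (Finset.mem_image_of_mem _ (Finset.mem_Ico.2 ⟨hi0, hlt⟩))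
  have hWmem : ∀ y ∈ W, (∃ i ≤ p, P i = y) ∨ ∃ i ≤ q, Q i = y := by
    intro y hy
    rcases Finset.mem_union.1 hy with hy | hy
    · obtain ⟨i, hi, rfl⟩ := Finset.mem_image.1 hy
      exact Or.inl ⟨i, by have := Finset.mem_range.1 hi; omega, rfl⟩
    · obtain ⟨i, hi, rfl⟩ := Finset.mem_image.1 hy
      exact Or.inr ⟨i, (Finset.mem_Ico.1 hi).2.le, rfl⟩
  have hcard : W.card ≤ p + q := by
    refine (Finset.card_union_le _ _).trans ?_
    have a1 := Finset.card_image_le (s := Finset.range (p + 1)) (f := P)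
    have a2 := Finset.card_image_le (s := Finset.Ico 1 q) (f := Q)
    simp only [Finset.card_range, Nat.card_Ico] at a1 a2
    omega
  -- The vertices of an edge of the link do not lie in `F`.
  have hdis : ∀ x y : V, {x, y} ∈ (Γ.link F).faces → x ∉ F ∧ y ∉ F := by
    rintro x y ⟨-, hd, -⟩
    simpa using hd
  have hWF : Disjoint W F := by
    rw [Finset.disjoint_left]
    intro y hy
    rcases hWmem y hy with ⟨i, hi, rfl⟩ | ⟨i, hi, rfl⟩
    · rcases hi.eq_or_lt with rfl | hlt
      · have := (hdis _ _ (hP (i - 1) (by omega)).2).2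
        rwa [Nat.sub_add_cancel hp] at this
      · exact (hdis _ _ (hP i hlt).2).1
    · rcases hi.eq_or_lt with rfl | hlt
      · have := (hdis _ _ (hQ (i - 1) (by omega)).2).2
        rwa [Nat.sub_add_cancel hq] at this
      · exact (hdis _ _ (hQ i hlt).2).1
  set K := (Γ.link F).induced W with hK
  have hcP : walkChain k P p ∈ K.chains k 2 := walkChain_mem_chains k K fun i hi =>
    ⟨(hP i hi).1, (hP i hi).2, by
      simp [Finset.insert_subset_iff, hPW i hi.le, hPW (i + 1) hi]⟩
  have hcQ : walkChain k Q q ∈ K.chains k 2 := walkChain_mem_chains k K fun i hi =>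
    ⟨(hQ i hi).1, (hQ i hi).2, by
      simp [Finset.insert_subset_iff, hQW i hi.le, hQW (i + 1) hi]⟩
  have hc : walkChain k P p - walkChain k Q q ∈ K.cycles k 1 := by
    refine ⟨Submodule.sub_mem _ hcP hcQ, ?_⟩
    rw [SetLike.mem_coe, LinearMap.mem_ker, map_sub]
    ext u
    rw [Pi.sub_apply, boundaryMap_walkChain, boundaryMap_walkChain, h0, h1]
    simp
  -- Only the first step of `P` contributes to the coefficient at the edge from `P 0` to `P 1`.
  have hval : ∀ (R : ℕ → V) (l : ℕ) (x : V), 1 ≤ l → (∀ i, 1 ≤ i → i ≤ l → R i ≠ R 0) →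
      walkChain k R l (Fin.cons (R 0) fun _ => x) = if x = R 1 then 1 else 0 := by
    intro R l x hl hR
    have e1 : (Fin.cons (R 0) (fun _ => x) : Fin 2 → V) 1 = x := rfl
    simp only [walkChain, Fin.cons_zero, e1]
    rw [Finset.sum_eq_single_of_mem 0 (Finset.mem_range.2 hl)]
    · simp [(hR 1 le_rfl hl).symm]
    · intro i hi hi0
      have hi := Finset.mem_range.1 hi
      simp [(hR i (by omega) hi.le).symm, (hR (i + 1) (by omega) hi).symm]
  have hnt : Nontrivial (K.ReducedHomology k 1) := by
    refine nontrivial_reducedHomology_one K hc (u := P 0) (x := P 1) ?_ ?_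
    · rw [Pi.sub_apply, hval P p _ hp hP0, h0, hval Q q _ hq hQ0]
      simp [hne]
    · rintro y hy0 hy1 ⟨hy, hyW⟩
      exact hno y (hWmem y (hyW (by simp))) hy0 hy1 hy
  calc Γ.girth k 1 ≤ (W.card : ℕ∞) := sInf_le ⟨F, W, hF, hWF, hnt, rfl⟩
    _ ≤ _ := by exact_mod_cast hcard

end Theta

section Skeleton

variable {V : Type*} [DecidableEq V]

/-- The graph of the edges of `Γ`. -/
def skeletonGraph (Γ : PreAbstractSimplicialComplex V) : SimpleGraph V where
  Adj x y := x ≠ y ∧ {x, y} ∈ Γ.faces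
  symm := ⟨fun x y h => ⟨h.1.symm, by rw [Finset.pair_comm]; exact h.2⟩⟩
  loopless := ⟨fun x h => h.1 rfl⟩

theorem link_empty_faces (Γ : PreAbstractSimplicialComplex V) (G : Finset V) :
    G ∈ (Γ.link ∅).faces ↔ G ∈ Γ.faces := by
  constructor
  · rintro ⟨-, -, h⟩
    simpa using h
  · intro h
    exact ⟨(Γ.isRelLowerSet_faces h).1, by simp, by simpa using h⟩

theorem skeletonGraph_adj_of_mem {Γ : PreAbstractSimplicialComplex V} {S : Finset V}
    (hS : S ∈ Γ.faces) {x y : V} (hx : x ∈ S) (hy : y ∈ S) (hxy : x ≠ y) :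
    Γ.skeletonGraph.Adj x y :=
  ⟨hxy, (Γ.isRelLowerSet_faces hS).2 (by simp [Finset.insert_subset_iff, hx, hy]) (by simp)⟩

variable [Fintype V] (k : Type*) [Field k]

/-- If the `1`-girth exceeds `3` then `Γ` is a flag complex: a minimal missing face `S` with at
least three vertices would give an empty triangle in the link of `S` minus three vertices. -/
theorem isFace_of_isClique {Γ : PreAbstractSimplicialComplex V}
    (hg : ((3 : ℕ) : ℕ∞) < Γ.girth k 1) :
    ∀ (m : ℕ) (S : Finset V), S.card = m → 2 ≤ m → Γ.skeletonGraph.IsClique S → S ∈ Γ.faces := by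
  intro m
  induction m with
  | zero => intro S _ h; omega
  | succ m ih =>
    intro S hS hm hcl
    rcases (by omega : m + 1 = 2 ∨ 2 ≤ m) with h2 | h2
    · obtain ⟨x, y, hxy, rfl⟩ := Finset.card_eq_two.1 (hS.trans h2)
      exact (hcl (by simp) (by simp) hxy).2
    obtain ⟨T, hTS, hT⟩ := Finset.exists_subset_card_eq (s := S) (n := 3) (by omega)
    obtain ⟨a, b, c, hab, hac, hbc, rfl⟩ := Finset.card_eq_three.1 hT
    have ha : a ∈ S := hTS (by simp)
    have hb : b ∈ S := hTS (by simp)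
    have hc : c ∈ S := hTS (by simp)
    have herase : ∀ x ∈ S, S.erase x ∈ Γ.faces := fun x hx =>
      ih _ (by rw [Finset.card_erase_of_mem hx]; omega) h2
        (hcl.subset (Finset.erase_subset _ _))
    set F := S \ {a, b, c} with hF
    have hFa : Γ.IsFace F := IsFace.mono (Or.inr (herase a ha)) fun x hx => by
      simp only [hF, Finset.mem_sdiff, Finset.mem_insert, Finset.mem_singleton, not_or] at hx
      exact Finset.mem_erase.2 ⟨hx.2.1, hx.1⟩
    have hlink : ∀ x y z, x ∈ S → y ∈ S → z ∈ S → x ≠ z → y ≠ z →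
        ({x, y, z} : Finset V) = {a, b, c} → {x, y} ∈ (Γ.link F).faces := by
      intro x y z hx hy hz hxz hyz he
      refine ⟨by simp, ?_, ?_⟩
      · rw [hF, ← he, Finset.disjoint_left]
        intro w hw
        simp only [Finset.mem_insert, Finset.mem_singleton] at hw
        simp only [Finset.mem_sdiff, Finset.mem_insert, Finset.mem_singleton]
        tauto
      · have : ({x, y} ∪ F : Finset V) = S.erase z := by
          rw [hF, ← he]
          ext w
          simp only [Finset.mem_union, Finset.mem_insert, Finset.mem_singleton,
            Finset.mem_sdiff, Finset.mem_erase]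
          by_cases h1 : w = x
          · subst h1; simp [hx, hxz]
          by_cases h2 : w = y
          · subst h2; simp [hy, hyz]
          by_cases h3 : w = z <;> simp [h1, h2, h3, hxz.symm, hyz.symm]
        rw [this]
        exact herase z hz
    by_contra hSf
    refine absurd (girth_one_le_of_walks k Γ hFa (P := fun i => if i = 0 then a else
      if i = 1 then b else c) (Q := fun i => if i = 0 then a else c) (p := 2) (q := 1)
      (by norm_num) le_rfl rfl (by simp) ?_ ?_ ?_ ?_ (by simpa using hbc) ?_) (not_le.2 hg)
    · intro i hi
      interval_cases i
      · exact ⟨by simpa using hab, by simpa using hlink a b c ha hb hc hac hbc rfl⟩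
      · exact ⟨by simpa using hbc, by
          simpa using hlink b c a hb hc ha hab.symm hac.symm (by ext; simp; tauto)⟩
    · intro i hi
      interval_cases i
      exact ⟨by simpa using hac, by
          simpa using hlink a c b ha hc hb hab hbc.symm (by ext; simp; tauto)⟩
    · intro i h1 h2
      interval_cases i
      · simpa using hab.symm
      · simpa using hac.symm
    · intro i h1 h2
      interval_cases i
      simpa using hac.symm
    · rintro y hy hya hyb ⟨-, -, hface⟩
      simp only [if_true, one_ne_zero, if_false] at hya hyb hface
      have hyc : y = c := by
        rcases hy with ⟨i, hi, rfl⟩ | ⟨i, hi, rfl⟩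
        · interval_cases i <;> simp_all
        · interval_cases i <;> simp_all
      subst hyc
      apply hSf
      have : ({y, a, b} ∪ F : Finset V) = S := by
        rw [hF]
        ext w
        simp only [Finset.mem_union, Finset.mem_insert, Finset.mem_singleton,
            Finset.mem_sdiff]
        by_cases h1 : w = a
        · subst h1; simp [ha]
        by_cases h2 : w = b
        · subst h2; simp [hb]
        by_cases h3 : w = y
        · subst h3; simp [hc]
        simp [h1, h2, h3]
      rwa [this] at hface

end Skeleton

end PreAbstractSimplicialComplex

/-! ### Locally induced walks -/

namespace SimpleGraph

variable {V : Type*}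

/-- A weak chordality condition on the closed walks of length at most `g`: if two walks `P` and `Q`
with `P 0 = Q 0` and `P p = Q q`, of total length `p + q ≤ g`, do not return to their starting point
and leave it along different edges, then the first edge of `P` spans a triangle with a vertex of
`P` or `Q`. -/
def ShortCyclesHaveTriangles (G : SimpleGraph V) (g : ℕ) : Prop :=
  ∀ (P Q : ℕ → V) (p q : ℕ), 1 ≤ p → 1 ≤ q → P 0 = Q 0 → P p = Q q →
    (∀ i < p, G.Adj (P i) (P (i + 1))) → (∀ i < q, G.Adj (Q i) (Q (i + 1))) →
    (∀ i, 1 ≤ i → i ≤ p → P i ≠ P 0) → (∀ i, 1 ≤ i → i ≤ q → Q i ≠ Q 0) →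
    P 1 ≠ Q 1 → p + q ≤ g →
    ∃ y, ((∃ i ≤ p, P i = y) ∨ ∃ i ≤ q, Q i = y) ∧ G.Adj y (P 0) ∧ G.Adj y (P 1)

/-- `P 0, …, P l` is a walk in which any three consecutive vertices induce a path. -/
structure IsLocallyInduced (G : SimpleGraph V) (P : ℕ → V) (l : ℕ) : Prop where
  adj : ∀ i < l, G.Adj (P i) (P (i + 1))
  ne : ∀ i, i + 2 ≤ l → P i ≠ P (i + 2)
  not_adj : ∀ i, i + 2 ≤ l → ¬ G.Adj (P i) (P (i + 2))

/-- A short locally induced walk is an induced path: a shortest chord would close a cycle whose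
edge at its starting point lies in no triangle. -/
theorem IsLocallyInduced.induced {G : SimpleGraph V} {g : ℕ} (hG : G.ShortCyclesHaveTriangles g)
    {P : ℕ → V} {l : ℕ} (h : G.IsLocallyInduced P l) (hl : l + 1 ≤ g) :
    ∀ m i, 2 ≤ m → i + m ≤ l → P i ≠ P (i + m) ∧ ¬ G.Adj (P i) (P (i + m)) := by
  intro m
  induction m using Nat.strong_induction_on with
  | _ m ih =>
  intro i hm him
  rcases (by omega : m = 2 ∨ 3 ≤ m) with rfl | hm3
  · exact ⟨h.ne i him, h.not_adj i him⟩
  have hne : P i ≠ P (i + m) := by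
    intro he
    apply (ih (m - 1) (by omega) i (by omega) (by omega)).2
    have := h.adj (i + (m - 1)) (by omega)
    rw [show i + (m - 1) + 1 = i + m by omega] at this
    rw [he]
    exact this.symm
  refine ⟨hne, fun hadj => ?_⟩
  have hP0 : ∀ t, 1 ≤ t → t ≤ m → P (i + t) ≠ P i := by
    intro t h1 h2
    rcases (by omega : t = 1 ∨ t = m ∨ 2 ≤ t ∧ t < m) with rfl | rfl | ⟨h3, h4⟩
    · exact (h.adj i (by omega)).ne'
    · exact hne.symm
    · exact (ih t h4 i h3 (by omega)).1.symm
  obtain ⟨y, hy, hy0, hy1⟩ := hG (fun t => P (i + t)) (fun t => if t = 0 then P i else P (i + m))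
    m 1 (by omega) le_rfl rfl (by simp) (fun t ht => h.adj (i + t) (by omega))
    (fun t ht => by
      obtain rfl : t = 0 := by omega
      simpa using hadj)
    hP0
    (fun t h1 h2 => by
      obtain rfl : t = 1 := by omega
      simpa using hne.symm)
    (by
      have := (ih (m - 1) (by omega) (i + 1) (by omega) (by omega)).1
      rw [show i + 1 + (m - 1) = i + m by omega] at this
      simpa using this)
    (by omega)
  have hy' : ∃ t ≤ m, P (i + t) = y := by
    rcases hy with hy | ⟨t, ht, rfl⟩
    · exact hy
    · rcases (by omega : t = 0 ∨ t = 1) with rfl | rfl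
      · exact ⟨0, by omega, by simp⟩
      · exact ⟨m, le_rfl, by simp⟩
  obtain ⟨t, ht, rfl⟩ := hy'
  simp only [add_zero] at hy0
  rcases (by omega : t = 0 ∨ t = 1 ∨ t = 2 ∨ 3 ≤ t) with rfl | rfl | rfl | h3
  · exact hy0.ne rfl
  · exact hy1.ne rfl
  · exact h.not_adj i (by omega) hy0.symm
  · apply (ih (t - 1) (by omega) (i + 1) (by omega) (by omega)).2
    rw [show i + 1 + (t - 1) = i + t by omega]
    exact hy1.symm

/-- Two short locally induced walks with the same end points have equal or adjacent first
vertices. -/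
theorem IsLocallyInduced.first_eq_or_adj {G : SimpleGraph V} {g : ℕ}
    (hG : G.ShortCyclesHaveTriangles g) {P Q : ℕ → V} {p q : ℕ} (hP : G.IsLocallyInduced P p)
    (hQ : G.IsLocallyInduced Q q) (hp : 1 ≤ p) (hq : 1 ≤ q) (h0 : P 0 = Q 0) (h1 : P p = Q q)
    (hpq : p + q ≤ g) : P 1 = Q 1 ∨ G.Adj (P 1) (Q 1) := by
  have key : ∀ {R : ℕ → V} {l : ℕ}, G.IsLocallyInduced R l → l + 1 ≤ g → ∀ i, 2 ≤ i → i ≤ l →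
      R 0 ≠ R i ∧ ¬ G.Adj (R 0) (R i) := by
    intro R l hR hl i h2 hil
    simpa using hR.induced hG hl i 0 h2 (by omega)
  have key' : ∀ {R : ℕ → V} {l : ℕ}, G.IsLocallyInduced R l → l + 1 ≤ g → ∀ i, 1 ≤ i → i ≤ l →
      R i ≠ R 0 := by
    intro R l hR hl i h2 hil
    rcases (by omega : i = 1 ∨ 2 ≤ i) with rfl | h2
    · exact (hR.adj 0 (by omega)).ne'
    · exact (key hR hl i h2 hil).1.symm
  by_contra! hcon
  obtain ⟨y, hy, hy0, hy1⟩ := hG P Q p q hp hq h0 h1 hP.adj hQ.adj (key' hP (by omega))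
    (key' hQ (by omega)) hcon.1 hpq
  rcases hy with ⟨i, hi, rfl⟩ | ⟨i, hi, rfl⟩
  · rcases (by omega : i = 0 ∨ i = 1 ∨ 2 ≤ i) with rfl | rfl | h2
    · exact hy0.ne rfl
    · exact hy1.ne rfl
    · exact (key hP (by omega) i h2 hi).2 hy0.symm
  · rcases (by omega : i = 0 ∨ i = 1 ∨ 2 ≤ i) with rfl | rfl | h2
    · exact hy0.ne h0.symm
    · exact hcon.2 hy1.symm
    · exact (key hQ (by omega) i h2 hi).2 (h0 ▸ hy0.symm)

section Counting

open scoped Classical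

variable [Fintype V]

/-- The possible next vertices `x` after the step from `u` to `v`: those for which `v x` is an edge
of `H` and `u, v, x` induces a path in the larger graph `G`. -/
noncomputable def nextVertices (G H : SimpleGraph V) (u v : V) : Finset V :=
  {x ∈ H.neighborFinset v | ¬ (x = u ∨ G.Adj u x)}

/-- The number of locally induced walks of `G` which start with the step from `u` to `v`, then make
`k` further steps along edges of `H`, and end at `w`. -/
noncomputable def numExtensionsTo (G H : SimpleGraph V) : ℕ → V → V → V → ℕ
  | 0, _, v, w => if v = w then 1 else 0
  | k + 1, u, v, w => ∑ x ∈ nextVertices G H u v, numExtensionsTo G H k v x w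

/-- The number of locally induced walks of `G` which start with the step from `u` to `v` and then
make `k` further steps along edges of `H`. -/
noncomputable def numExtensions (G H : SimpleGraph V) : ℕ → V → V → ℕ
  | 0, _, _ => 1
  | k + 1, u, v => ∑ x ∈ nextVertices G H u v, numExtensions G H k v x

theorem numExtensions_eq_sum (G H : SimpleGraph V) (k : ℕ) (u v : V) :
    numExtensions G H k u v = ∑ w, numExtensionsTo G H k u v w := by
  induction k generalizing u v with
  | zero => simp [numExtensions, numExtensionsTo]
  | succ k ih =>
    simp only [numExtensions, numExtensionsTo]
    rw [Finset.sum_comm]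
    exact Finset.sum_congr rfl fun x _ => ih v x

variable {G H : SimpleGraph V}

theorem exists_isLocallyInduced (hHG : H ≤ G) {k : ℕ} {u v w : V} (huv : G.Adj u v)
    (h : numExtensionsTo G H k u v w ≠ 0) :
    ∃ P : ℕ → V, P 0 = u ∧ P 1 = v ∧ P (k + 1) = w ∧ G.IsLocallyInduced P (k + 1) := by
  induction k generalizing u v with
  | zero =>
    have hvw : v = w := by
      by_contra hne
      exact h (by simp [numExtensionsTo, hne])
    refine ⟨fun i => if i = 0 then u else v, by simp, by simp, by simp [hvw], ?_, ?_, ?_⟩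
    · intro i hi
      obtain rfl : i = 0 := by omega
      simpa using huv
    · intro i hi; omega
    · intro i hi; omega
  | succ k ih =>
    obtain ⟨x, hx, hne⟩ := Finset.exists_ne_zero_of_sum_ne_zero h
    simp only [nextVertices, Finset.mem_filter, mem_neighborFinset, not_or] at hx
    obtain ⟨P, h0, h1, hl, hP⟩ := ih (hHG hx.1) hne
    refine ⟨fun i => if i = 0 then u else P (i - 1), by simp, by simp [h0], by simp [hl],
      ?_, ?_, ?_⟩
    · intro i hi
      rcases Nat.eq_zero_or_pos i with rfl | hi0
      · simpa [h0] using huv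
      · have := hP.adj (i - 1) (by omega)
        rw [Nat.sub_add_cancel hi0] at this
        simpa [hi0.ne'] using this
    · intro i hi
      rcases Nat.eq_zero_or_pos i with rfl | hi0
      · simpa [h1] using (Ne.symm hx.2.1)
      · have := hP.ne (i - 1) (by omega)
        rw [show i - 1 + 2 = i + 1 by omega] at this
        simpa [hi0.ne'] using this
    · intro i hi
      rcases Nat.eq_zero_or_pos i with rfl | hi0
      · simpa [h1] using hx.2.2
      · have := hP.not_adj (i - 1) (by omega)
        rw [show i - 1 + 2 = i + 1 by omega] at this
        simpa [hi0.ne'] using this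

variable {g d : ℕ}

/-- The possible second vertices of the walks counted here form a clique with `v`, so that there
are at most `d - 1` of them. -/
theorem numExtensionsTo_le (hHG : H ≤ G) (hG : G.ShortCyclesHaveTriangles g)
    (hd : ∀ S : Finset V, G.IsClique S → S.card ≤ d) {k : ℕ} (hk : 1 ≤ k) (hkg : 2 * k ≤ g)
    {u v w : V} : numExtensionsTo G H k u v w ≤ (d - 1) ^ (k - 1) := by
  induction k, hk using Nat.le_induction generalizing u v with
  | base =>
    simp only [numExtensionsTo, Finset.sum_ite_eq', Nat.sub_self, pow_zero]
    split_ifs <;> simp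
  | succ k hk ih =>
    set X : Finset V := {x ∈ nextVertices G H u v | numExtensionsTo G H k v x w ≠ 0} with hX
    have hXadj : ∀ x ∈ X, G.Adj v x := by
      intro x hx
      simp only [hX, nextVertices, Finset.mem_filter, mem_neighborFinset] at hx
      exact hHG hx.1.1
    have hcl : G.IsClique (insert v X : Finset V) := by
      rw [Finset.coe_insert, isClique_insert]
      refine ⟨?_, fun x hx _ => hXadj x hx⟩
      intro x hx y hy hxy
      obtain ⟨P, hP0, hP1, hPl, hP⟩ := exists_isLocallyInduced hHG (hXadj x hx)
        (Finset.mem_filter.1 hx).2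
      obtain ⟨Q, hQ0, hQ1, hQl, hQ⟩ := exists_isLocallyInduced hHG (hXadj y hy)
        (Finset.mem_filter.1 hy).2
      have := hP.first_eq_or_adj hG hQ (by omega) (by omega) (hP0.trans hQ0.symm)
        (hPl.trans hQl.symm) (by omega)
      rw [hP1, hQ1] at this
      exact this.resolve_left hxy
    have hcard := hd _ hcl
    rw [Finset.card_insert_of_notMem (fun h => (hXadj v h).ne rfl)] at hcard
    calc numExtensionsTo G H (k + 1) u v w
        = ∑ x ∈ X, numExtensionsTo G H k v x w := by
          rw [hX, Finset.sum_filter_ne_zero]; rfl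
      _ ≤ ∑ x ∈ X, (d - 1) ^ (k - 1) := Finset.sum_le_sum fun x _ => ih (by omega)
      _ = X.card * (d - 1) ^ (k - 1) := by simp
      _ ≤ (d - 1) * (d - 1) ^ (k - 1) := Nat.mul_le_mul_right _ (by omega)
      _ = (d - 1) ^ (k + 1 - 1) := by
          rw [← pow_succ', Nat.sub_add_cancel hk, Nat.add_sub_cancel]

theorem numExtensions_le (hHG : H ≤ G) (hG : G.ShortCyclesHaveTriangles g)
    (hd : ∀ S : Finset V, G.IsClique S → S.card ≤ d) {k : ℕ} (hk : 1 ≤ k) (hkg : 2 * k ≤ g)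
    (u v : V) : numExtensions G H k u v ≤ Fintype.card V * (d - 1) ^ (k - 1) := by
  rw [numExtensions_eq_sum]
  refine (Finset.sum_le_sum fun w _ => numExtensionsTo_le hHG hG hd hk hkg).trans ?_
  simp

/-- The walks counted here that start with the step from `u` to `v` and those that start with the
step from `v` to `u` end at different vertices. -/
theorem numExtensions_add_numExtensions_le (hHG : H ≤ G) (hG : G.ShortCyclesHaveTriangles g)
    (hd : ∀ S : Finset V, G.IsClique S → S.card ≤ d) {k : ℕ} (hk : 1 ≤ k) (hkg : 2 * k + 1 ≤ g)
    {u v : V} (huv : G.Adj u v) :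
    numExtensions G H k u v + numExtensions G H k v u ≤ Fintype.card V * (d - 1) ^ (k - 1) := by
  rw [numExtensions_eq_sum, numExtensions_eq_sum, ← Finset.sum_add_distrib]
  have : ∀ w, numExtensionsTo G H k u v w + numExtensionsTo G H k v u w ≤ (d - 1) ^ (k - 1) := by
    intro w
    have h1 := numExtensionsTo_le hHG hG hd hk (by omega) (u := u) (v := v) (w := w)
    have h2 := numExtensionsTo_le hHG hG hd hk (by omega) (u := v) (v := u) (w := w)
    by_cases e1 : numExtensionsTo G H k u v w = 0
    · omega
    by_cases e2 : numExtensionsTo G H k v u w = 0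
    · omega
    exfalso
    obtain ⟨P, hP0, hP1, hPl, hP⟩ := exists_isLocallyInduced hHG huv e1
    obtain ⟨Q, hQ0, hQ1, hQl, hQ⟩ := exists_isLocallyInduced hHG huv.symm e2
    have hP' : G.IsLocallyInduced (fun i => P (i + 1)) k :=
      ⟨fun i hi => hP.adj (i + 1) (by omega), fun i hi => hP.ne (i + 1) (by omega),
        fun i hi => hP.not_adj (i + 1) (by omega)⟩
    have := hQ.first_eq_or_adj hG hP' (by omega) hk (hQ0.trans hP1.symm) (hQl.trans hPl.symm)
      (by omega)
    rw [hQ1, ← hP0] at this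
    exact this.elim (hP.ne 0 (by omega)) (hP.not_adj 0 (by omega))
  refine (Finset.sum_le_sum fun w _ => this w).trans ?_
  simp

end Counting

end SimpleGraph

/-! ### A lower bound on the number of walks by entropy -/

/-- `z = (1 - K)⁻¹ 1` for a nonnegative matrix `K` with small row sums. -/
theorem exists_eq_one_add_mulVec {ι : Type*} [Fintype ι] [DecidableEq ι]
    (K : ι → ι → ℝ) (hK : ∀ u w, 0 ≤ K u w) {c : ℝ}
    (hc : c < 1) (hrow : ∀ u, ∑ w, K u w ≤ c) :
    ∃ z : ι → ℝ, (∀ u, z u = 1 + ∑ w, K u w * z w) ∧ ∀ u, 1 ≤ z u ∧ (1 - c) * z u ≤ 1 := by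
  have hdet : (1 - Matrix.of K).det ≠ 0 := by
    apply det_ne_zero_of_sum_row_lt_diag
    intro u
    have h1 : ∑ w ∈ Finset.univ.erase u, ‖(1 - Matrix.of K) u w‖
        = ∑ w ∈ Finset.univ.erase u, K u w := by
      refine Finset.sum_congr rfl fun w hw => ?_
      have : u ≠ w := (Finset.ne_of_mem_erase hw).symm
      simp [Matrix.one_apply_ne this, abs_of_nonneg (hK u w)]
    have h2 := Finset.sum_erase_add Finset.univ (K u) (Finset.mem_univ u)
    have h3 : 1 - K u u ≤ ‖(1 - Matrix.of K) u u‖ := by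
      simpa using le_abs_self (1 - K u u)
    rw [h1]
    linarith [hrow u]
  set z := (1 - Matrix.of K)⁻¹.mulVec 1 with hz
  have hzeq : ∀ u, z u = 1 + ∑ w, K u w * z w := by
    intro u
    have h : (1 - Matrix.of K).mulVec z = 1 := by
      rw [hz, Matrix.mulVec_mulVec, Matrix.mul_nonsing_inv _ (isUnit_iff_ne_zero.2 hdet),
        Matrix.one_mulVec]
    have h' := congrFun h u
    rw [Matrix.sub_mulVec, Matrix.one_mulVec] at h'
    simp only [Pi.sub_apply, Pi.one_apply, Matrix.mulVec, dotProduct, Matrix.of_apply] at h'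
    linarith
  refine ⟨z, hzeq, ?_⟩
  have hnn : ∀ u, 0 ≤ z u := by
    by_contra! hneg
    obtain ⟨u, hu⟩ := hneg
    obtain ⟨m, -, hm⟩ := Finset.exists_min_image Finset.univ z ⟨u, Finset.mem_univ u⟩
    have hm0 : z m < 0 := (hm u (Finset.mem_univ u)).trans_lt hu
    have h1 : ∑ w, K m w * z m ≤ ∑ w, K m w * z w :=
      Finset.sum_le_sum fun w _ => mul_le_mul_of_nonneg_left (hm w (Finset.mem_univ w)) (hK m w)
    rw [← Finset.sum_mul] at h1
    nlinarith [hzeq m, hrow m]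
  intro u
  refine ⟨?_, ?_⟩
  · rw [hzeq u]
    linarith [Finset.sum_nonneg fun w (_ : w ∈ Finset.univ) => mul_nonneg (hK u w) (hnn w)]
  · obtain ⟨m, -, hm⟩ := Finset.exists_max_image Finset.univ z ⟨u, Finset.mem_univ u⟩
    have h1 : ∑ w, K m w * z w ≤ ∑ w, K m w * z m :=
      Finset.sum_le_sum fun w _ => mul_le_mul_of_nonneg_left (hm w (Finset.mem_univ w)) (hK m w)
    rw [← Finset.sum_mul] at h1
    have h2 := hm u (Finset.mem_univ u)
    nlinarith [hzeq m, hrow m, hnn m]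

/-- If every row of a symmetric relation `B` on `N` has at most `β |N|` elements, then there is a
symmetric doubly stochastic matrix on `N` which vanishes on `B` and whose entries are not much
larger than `1 / |N|`. With `z = 1 + K z`, where `K u w = (b_u [u = w] + [B u w]) / |N|` and `b_u`
is the size of row `u` of `B`, the matrix `z u + z w`, restricted to the complement of `B`, has
constant row sums. -/
theorem exists_doubly_stochastic {ι : Type*} [Fintype ι] [DecidableEq ι]
    (N : Finset ι) (hN : N.Nonempty) (B : ι → ι → Prop)
    [DecidableRel B] (hB : ∀ u w, B u w → B w u) {β : ℝ} (hβ0 : 0 ≤ β) (hβ : 2 * β < 1)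
    (hrow : ∀ u ∈ N, (({w ∈ N | B u w}.card : ℕ) : ℝ) ≤ β * N.card) :
    ∃ p : ι → ι → ℝ, (∀ u w, 0 ≤ p u w) ∧ (∀ u w, p u w = p w u) ∧ (∀ u w, B u w → p u w = 0) ∧
      (∀ u ∈ N, ∑ w ∈ N, p u w = 1) ∧ ∀ u w, p u w * ((1 - 2 * β) * N.card) ≤ 1 := by
  set D : ℝ := (N.card : ℝ) with hD
  have hDpos : 0 < D := by rw [hD]; exact_mod_cast hN.card_pos
  set b : ι → ℝ := fun u => ({w ∈ N | B u w}.card : ℕ) with hb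
  have hbsum : ∀ u, b u = ∑ w ∈ N, if B u w then (1 : ℝ) else 0 := by
    intro u; simp [hb]
  set K : ι → ι → ℝ := fun u w => if u ∈ N ∧ w ∈ N then
    ((if u = w then b u else 0) + if B u w then 1 else 0) / D else 0 with hK
  have hb0 : ∀ u, 0 ≤ b u := fun u => Nat.cast_nonneg _
  have hKsum : ∀ u ∈ N, ∀ f : ι → ℝ, ∑ w, K u w * f w =
      (b u * f u + ∑ w ∈ N, if B u w then f w else 0) / D := by
    intro u hu f
    rw [← Finset.sum_subset (Finset.subset_univ N) (fun w _ hw => by simp [hK, hw])]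
    have : ∀ w ∈ N, K u w * f w =
        (if u = w then b u * f w else 0) / D + (if B u w then f w else 0) / D := by
      intro w hw
      simp only [hK, hu, hw, and_self, if_true]
      split_ifs <;> ring
    rw [Finset.sum_congr rfl this, Finset.sum_add_distrib, ← Finset.sum_div, ← Finset.sum_div,
      Finset.sum_ite_eq, if_pos hu, add_div]
  obtain ⟨z, hz, hz1⟩ := exists_eq_one_add_mulVec K (c := 2 * β)
    (by
      intro u w
      simp only [hK]
      have := hb0 u
      split_ifs <;> positivity)
    hβ
    (by
      intro u
      by_cases hu : u ∈ N
      · have h := hKsum u hu (fun _ => 1)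
        simp only [mul_one] at h
        rw [h, ← hbsum, div_le_iff₀ hDpos]
        linarith [hrow u hu]
      · simp only [hK, hu, false_and, if_false, Finset.sum_const_zero]
        linarith)
  set Z := ∑ w ∈ N, z w with hZ
  have hZD : D ≤ Z := by
    have := Finset.card_nsmul_le_sum N z 1 (fun w _ => (hz1 w).1)
    simpa using this
  refine ⟨fun u w => if B u w then 0 else (z u + z w) / (D + Z), ?_, ?_, ?_, ?_, ?_⟩
  · intro u w
    have h1 := (hz1 u).1
    have h2 := (hz1 w).1
    dsimp only
    split_ifs
    · exact le_rfl
    · exact div_nonneg (by linarith) (by linarith)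
  · intro u w
    have : B u w ↔ B w u := ⟨hB u w, hB w u⟩
    simp only [this, add_comm (z u)]
  · intro u w h
    simp [h]
  · intro u hu
    have e : ∀ w ∈ N, (if B u w then 0 else (z u + z w) / (D + Z)) =
        ((z u + z w) - (if B u w then (1 : ℝ) else 0) * z u - if B u w then z w else 0)
          / (D + Z) := by
      intro w _
      split_ifs <;> ring
    rw [Finset.sum_congr rfl e, ← Finset.sum_div, Finset.sum_sub_distrib, Finset.sum_sub_distrib,
      Finset.sum_add_distrib, ← Finset.sum_mul, ← hbsum, Finset.sum_const, nsmul_eq_mul,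
      div_eq_one_iff_eq (by linarith)]
    have h := hz u
    rw [hKsum u hu z] at h
    field_simp at h
    linarith
  · intro u w
    dsimp only
    split_ifs
    · simp
    · rw [div_mul_eq_mul_div, div_le_one (by linarith)]
      nlinarith [(hz1 u).2, (hz1 w).2]

/-- Jensen's inequality for the logarithm of a sum, in entropy form: the weights `p` are at most
`1 / c`. -/
theorem sum_mul_log_add_log_le {ι : Type*} {N M : Finset ι} (hMN : M ⊆ N) {p a : ι → ℝ}
    {c : ℝ} (hc : 0 < c)
    (hp : ∀ w, 0 ≤ p w) (hpM : ∀ w ∈ N, w ∉ M → p w = 0) (hsum : ∑ w ∈ N, p w = 1)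
    (hpc : ∀ w, p w * c ≤ 1) (ha : ∀ w ∈ N, 1 ≤ a w) :
    ∑ w ∈ N, p w * Real.log (a w) + Real.log c ≤ Real.log (∑ w ∈ M, a w) := by
  have hJ := strictConcaveOn_log_Ioi.concaveOn.le_map_sum (t := N) (w := p) (p := a)
    (fun w _ => hp w) hsum (fun w hw => lt_of_lt_of_le one_pos (ha w hw))
  simp only [smul_eq_mul] at hJ
  have hpos : 1 ≤ ∑ w ∈ N, p w * a w := by
    rw [← hsum]
    exact Finset.sum_le_sum fun w hw => le_mul_of_one_le_right (hp w) (ha w hw)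
  have hle : (∑ w ∈ N, p w * a w) * c ≤ ∑ w ∈ M, a w := by
    rw [← Finset.sum_subset hMN (f := fun w => p w * a w)
      (fun w hw hwM => by rw [hpM w hw hwM, zero_mul]), Finset.sum_mul]
    refine Finset.sum_le_sum fun w hw => ?_
    have := mul_le_mul_of_nonneg_right (hpc w) (zero_le_one.trans (ha w (hMN hw)))
    linarith
  calc _ ≤ Real.log (∑ w ∈ N, p w * a w) + Real.log c := by linarith
    _ = Real.log ((∑ w ∈ N, p w * a w) * c) :=
        (Real.log_mul (by linarith) hc.ne').symm
    _ ≤ _ := Real.log_le_log (by positivity) hle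

namespace SimpleGraph

open scoped Classical

variable {V : Type*} [Fintype V] {G H : SimpleGraph V} {θ : ℝ}

theorem sum_sum_neighborFinset_comm (H : SimpleGraph V) (f : V → V → ℝ) :
    ∑ v, ∑ u ∈ H.neighborFinset v, f u v = ∑ v, ∑ u ∈ H.neighborFinset v, f v u := by
  simp only [neighborFinset_eq_filter, Finset.sum_filter]
  rw [Finset.sum_comm]
  simp only [H.adj_comm]

theorem one_le_numExtensions (hne : ∀ u v, H.Adj u v → (nextVertices G H u v).Nonempty) (k : ℕ)
    {u v : V} (huv : H.Adj u v) : 1 ≤ numExtensions G H k u v := by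
  induction k generalizing u v with
  | zero => exact le_rfl
  | succ k ih =>
    obtain ⟨x, hx⟩ := hne u v huv
    have hvx : H.Adj v x := by
      simpa using (Finset.mem_filter.1 hx).1
    exact (ih hvx).trans (Finset.single_le_sum (f := fun x => numExtensions G H k v x)
      (fun _ _ => Nat.zero_le _) hx)

theorem degree_pos_of_adj {u v : V} (h : H.Adj u v) : (0 : ℝ) < H.degree v := by
  exact_mod_cast (H.degree_pos_iff_exists_adj v).2 ⟨u, h.symm⟩

theorem nextVertices_nonempty (hθ : 2 * θ < 1) (hrow : ∀ u v, H.Adj u v →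
      (({w ∈ H.neighborFinset v | w = u ∨ G.Adj u w}.card : ℕ) : ℝ) ≤ θ * H.degree v) {u v : V}
    (huv : H.Adj u v) : (nextVertices G H u v).Nonempty := by
  by_contra hemp
  rw [Finset.not_nonempty_iff_eq_empty, nextVertices, Finset.filter_eq_empty_iff] at hemp
  have h := hrow u v huv
  rw [Finset.filter_true_of_mem (fun x hx => not_not.1 (hemp hx)), card_neighborFinset_eq_degree]
    at h
  nlinarith [degree_pos_of_adj huv]

/-- The random walk on the directed edges of `H` given by doubly stochastic matrices at the
vertices preserves the uniform distribution; its entropy bounds the number of walks from below. -/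
theorem le_sum_log_numExtensions (hθ0 : 0 ≤ θ) (hθ : 2 * θ < 1)
    (hrow : ∀ u v, H.Adj u v →
      (({w ∈ H.neighborFinset v | w = u ∨ G.Adj u w}.card : ℕ) : ℝ) ≤ θ * H.degree v) (k : ℕ) :
    k * ∑ v, H.degree v * Real.log ((1 - 2 * θ) * H.degree v) ≤
      ∑ v, ∑ u ∈ H.neighborFinset v, Real.log (numExtensions G H k u v) := by
  have hne : ∀ u v, H.Adj u v → (nextVertices G H u v).Nonempty :=
    fun u v huv => nextVertices_nonempty hθ hrow huv
  induction k with
  | zero => simp [numExtensions]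
  | succ k ih =>
    have hstep : ∀ v, ∑ u ∈ H.neighborFinset v, Real.log (numExtensions G H k v u) +
        H.degree v * Real.log ((1 - 2 * θ) * H.degree v) ≤
        ∑ u ∈ H.neighborFinset v, Real.log (numExtensions G H (k + 1) u v) := by
      intro v
      rcases (H.neighborFinset v).eq_empty_or_nonempty with hemp | hN
      · have : H.degree v = 0 := by rw [← card_neighborFinset_eq_degree, hemp]; rfl
        simp [hemp, this]
      obtain ⟨p, hp0, hps, hpB, hp1, hpc⟩ := exists_doubly_stochastic (H.neighborFinset v) hN
        (fun u w => w = u ∨ G.Adj u w)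
        (fun u w h => h.elim (fun h => Or.inl h.symm) fun h => Or.inr h.symm) hθ0 hθ
        (fun u hu => by
          have := hrow u v ((H.mem_neighborFinset v u).1 hu).symm
          rwa [card_neighborFinset_eq_degree])
      rw [card_neighborFinset_eq_degree] at hpc
      obtain ⟨u0, hu0⟩ := hN
      have hc : 0 < (1 - 2 * θ) * H.degree v :=
        mul_pos (by linarith) (degree_pos_of_adj ((H.mem_neighborFinset v u0).1 hu0).symm)
      have hJ : ∀ u ∈ H.neighborFinset v, ∑ w ∈ H.neighborFinset v,
          p u w * Real.log (numExtensions G H k v w) + Real.log ((1 - 2 * θ) * H.degree v) ≤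
          Real.log (numExtensions G H (k + 1) u v) := by
        intro u hu
        have := sum_mul_log_add_log_le (N := H.neighborFinset v) (M := nextVertices G H u v)
          (Finset.filter_subset _ _) (p := p u) (a := fun w => (numExtensions G H k v w : ℝ)) hc
          (hp0 u) (fun w hw hwM => hpB u w (by
            by_contra hcon
            exact hwM (Finset.mem_filter.2 ⟨hw, hcon⟩))) (hp1 u hu) (hpc u)
          (fun w hw => by
            exact_mod_cast one_le_numExtensions hne k ((H.mem_neighborFinset v w).1 hw))
        simpa [numExtensions] using this
      refine le_trans (le_of_eq ?_) (Finset.sum_le_sum hJ)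
      rw [Finset.sum_add_distrib, Finset.sum_comm, Finset.sum_const, card_neighborFinset_eq_degree,
        nsmul_eq_mul]
      congr 1
      refine Finset.sum_congr rfl fun w hw => ?_
      rw [← Finset.sum_mul, Finset.sum_congr rfl fun u _ => hps u w, hp1 w hw, one_mul]
    have h1 := Finset.sum_le_sum fun v (_ : v ∈ Finset.univ) => hstep v
    rw [Finset.sum_add_distrib, ← sum_sum_neighborFinset_comm H
      (fun u v => Real.log (numExtensions G H k u v))] at h1
    push_cast
    linarith

/-- By convexity of `x log x`, the mean over the directed edges of `H` of the logarithm of the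
degree is at least the logarithm of the average degree `a`. -/
theorem sum_degree_mul_log_le [Nonempty V] (hθ : 2 * θ < 1) {a : ℝ} (ha : 0 < a)
    (hsum : ∑ v, (H.degree v : ℝ) = a * Fintype.card V) :
    a * Fintype.card V * Real.log ((1 - 2 * θ) * a) ≤
      ∑ v, H.degree v * Real.log ((1 - 2 * θ) * H.degree v) := by
  have hn : (0 : ℝ) < Fintype.card V := by exact_mod_cast Fintype.card_pos
  have hJ := Real.convexOn_mul_log.map_sum_le (t := Finset.univ)
    (w := fun _ : V => (Fintype.card V : ℝ)⁻¹) (p := fun v => (H.degree v : ℝ))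
    (fun _ _ => by positivity) (by simp [hn.ne'])
    (fun v _ => Set.mem_Ici.2 (Nat.cast_nonneg (H.degree v)))
  simp only [smul_eq_mul, ← Finset.mul_sum, hsum] at hJ
  rw [show (Fintype.card V : ℝ)⁻¹ * (a * Fintype.card V) = a by field_simp] at hJ
  rw [inv_mul_eq_div, le_div_iff₀ hn] at hJ
  have e : ∀ v, (H.degree v : ℝ) * Real.log ((1 - 2 * θ) * H.degree v) =
      H.degree v * Real.log (1 - 2 * θ) + H.degree v * Real.log (H.degree v) := by
    intro v
    rcases eq_or_ne (H.degree v : ℝ) 0 with h | h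
    · simp [h]
    · rw [Real.log_mul (by linarith) h, mul_add]
  rw [Finset.sum_congr rfl fun v _ => e v, Finset.sum_add_distrib, ← Finset.sum_mul, hsum,
    Real.log_mul (by linarith) ha.ne']
  linarith

/-- If each directed edge, together with its reverse, has at most `2 M` extensions by `k` steps,
then `((1 - 2 θ) a) ^ k ≤ M` for the average degree `a` of `H`. -/
theorem pow_average_degree_le [Nonempty V] (hθ0 : 0 ≤ θ) (hθ : 2 * θ < 1)
    (hrow : ∀ u v, H.Adj u v →
      (({w ∈ H.neighborFinset v | w = u ∨ G.Adj u w}.card : ℕ) : ℝ) ≤ θ * H.degree v)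
    {a : ℝ} (ha : 0 < a) (hsum : ∑ v, (H.degree v : ℝ) = a * Fintype.card V) {k : ℕ} {M : ℝ}
    (hM0 : 0 < M) (hM : ∀ u v, H.Adj u v →
      (numExtensions G H k u v + numExtensions G H k v u : ℝ) ≤ 2 * M) :
    ((1 - 2 * θ) * a) ^ k ≤ M := by
  have hn : (0 : ℝ) < Fintype.card V := by exact_mod_cast Fintype.card_pos
  have h1 := le_sum_log_numExtensions hθ0 hθ hrow k
  have h2 := sum_degree_mul_log_le hθ ha hsum
  have hlog : ∀ x y : ℝ, x + y ≤ 2 * M → 1 ≤ x → 1 ≤ y →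
      Real.log x + Real.log y ≤ 2 * Real.log M := by
    intro x y hxy hx1 hy1
    rw [← Real.log_mul (by positivity) (by positivity), ← Nat.cast_two, ← Real.log_pow]
    exact Real.log_le_log (by positivity) (by nlinarith [sq_nonneg (x - y)])
  have h3 : 2 * ∑ v, ∑ u ∈ H.neighborFinset v, Real.log (numExtensions G H k u v) ≤
      a * Fintype.card V * (2 * Real.log M) := by
    rw [two_mul]
    nth_rewrite 2 [sum_sum_neighborFinset_comm H
      (fun u v => Real.log (numExtensions G H k u v))]
    rw [← Finset.sum_add_distrib, ← hsum, Finset.sum_mul]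
    refine Finset.sum_le_sum fun v _ => ?_
    rw [← Finset.sum_add_distrib, ← card_neighborFinset_eq_degree, ← nsmul_eq_mul]
    refine Finset.sum_le_card_nsmul _ _ _ fun u hu => ?_
    have hvu : H.Adj v u := (H.mem_neighborFinset v u).1 hu
    have hF : ∀ {x y}, H.Adj x y → (1 : ℝ) ≤ numExtensions G H k x y := fun {x y} h => by
      exact_mod_cast one_le_numExtensions (fun _ _ h' => nextVertices_nonempty hθ hrow h') k h
    exact hlog _ _ (hM u v hvu.symm) (hF hvu.symm) (hF hvu)
  have h4 : (k : ℝ) * Real.log ((1 - 2 * θ) * a) ≤ Real.log M := by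
    have hpos : 0 < a * Fintype.card V := by positivity
    have := mul_le_mul_of_nonneg_left h2 (Nat.cast_nonneg (α := ℝ) k)
    refine le_of_mul_le_mul_left ?_ hpos
    linarith
  rw [← Real.log_pow] at h4
  exact (Real.log_le_log_iff (pow_pos (mul_pos (by linarith) ha) k) hM0).1 h4

end SimpleGraph

/-! ### Thinning out the edges in many triangles -/

namespace SimpleGraph

open scoped Classical

variable {V : Type*} [Fintype V] {G : SimpleGraph V} {d : ℕ}

/-- Without induced `4`-cycles, the common neighbours of two nonadjacent vertices form a clique. -/
theorem card_inter_neighborFinset_le {g : ℕ} (hG : G.ShortCyclesHaveTriangles g) (hg : 4 ≤ g)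
    (hd : ∀ S : Finset V, G.IsClique S → S.card ≤ d) {x y : V} (hxy : x ≠ y)
    (hadj : ¬ G.Adj x y) : (G.neighborFinset x ∩ G.neighborFinset y).card ≤ d := by
  apply hd
  intro a ha b hb hab
  simp only [Finset.coe_inter, Set.mem_inter_iff, Finset.mem_coe, mem_neighborFinset] at ha hb
  by_contra hnab
  obtain ⟨z, hz, hza, hzx⟩ := hG (fun i => if i = 0 then a else if i = 1 then x else b)
    (fun i => if i = 0 then a else if i = 1 then y else b) 2 2 (by norm_num) (by norm_num)
    (by simp) (by simp)
    (fun i hi => by interval_cases i; exacts [by simpa using ha.1.symm, by simpa using hb.1])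
    (fun i hi => by interval_cases i; exacts [by simpa using ha.2.symm, by simpa using hb.2])
    (fun i h1 h2 => by interval_cases i; exacts [by simpa using ha.1.ne, by simpa using hab.symm])
    (fun i h1 h2 => by interval_cases i; exacts [by simpa using ha.2.ne, by simpa using hab.symm])
    (by simpa using hxy) hg
  simp only [if_true, one_ne_zero, if_false] at hza hzx
  have hz' : z = a ∨ z = x ∨ z = b ∨ z = y := by
    rcases hz with ⟨i, hi, rfl⟩ | ⟨i, hi, rfl⟩ <;> interval_cases i <;> simp
  rcases hz' with rfl | rfl | rfl | rfl
  · exact hza.ne rfl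
  · exact hzx.ne rfl
  · exact hnab hza.symm
  · exact hadj hzx.symm

/-- A Bonferroni inequality for sets with small pairwise intersections. -/
theorem sum_card_le_card_biUnion_add {ι α : Type*} (T : Finset ι) (A : ι → Finset α) (d : ℕ)
    (h : ∀ x ∈ T, ∀ y ∈ T, x ≠ y → (A x ∩ A y).card ≤ d) :
    ∑ x ∈ T, (A x).card ≤ (T.biUnion A).card + T.card ^ 2 * d := by
  induction T using Finset.induction_on with
  | empty => simp
  | insert a T ha ih =>
    have ih := ih fun x hx y hy => h x (Finset.mem_insert_of_mem hx) y (Finset.mem_insert_of_mem hy)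
    have h1 := Finset.card_union_add_card_inter (A a) (T.biUnion A)
    have h2 : (A a ∩ T.biUnion A).card ≤ T.card * d := by
      rw [Finset.inter_biUnion]
      exact Finset.card_biUnion_le_card_mul _ _ _ fun x hx =>
        h a (Finset.mem_insert_self _ _) x (Finset.mem_insert_of_mem hx) fun e => ha (e ▸ hx)
    rw [Finset.sum_insert ha, Finset.biUnion_insert, Finset.card_insert_of_notMem ha]
    nlinarith

/-- A vertex set whose independent subsets have at most `t` vertices has at most `(t + t ^ 2) d`
vertices: each vertex outside a maximum independent set `I` has either two neighbours in `I` or just one, and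
the vertices with the single neighbour `x` in `I` form a clique with `x`. -/
theorem card_le_of_forall_isIndepSet (hd : ∀ S : Finset V, G.IsClique S → S.card ≤ d)
    (hco : ∀ x y, x ≠ y → ¬ G.Adj x y → (G.neighborFinset x ∩ G.neighborFinset y).card ≤ d)
    {t : ℕ} (S : Finset V) (hS : ∀ T ⊆ S, G.IsIndepSet T → T.card ≤ t) :
    S.card ≤ (t + t ^ 2) * d := by
  obtain ⟨I, hI, hmax⟩ := Finset.exists_max_image
    (S.powerset.filter fun T : Finset V => G.IsIndepSet T)
    Finset.card ⟨∅, by simp [IsIndepSet]⟩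
  obtain ⟨hIS, hind⟩ := Finset.mem_filter.1 hI
  rw [Finset.mem_powerset] at hIS
  replace hmax : ∀ T ⊆ S, G.IsIndepSet T → T.card ≤ I.card := fun T hT hT' =>
    hmax T (Finset.mem_filter.2 ⟨Finset.mem_powerset.2 hT, hT'⟩)
  have hIt : I.card ≤ t := hS I hIS hind
  set R : V → Finset V := fun x =>
    {u ∈ S | u = x ∨ G.Adj x u ∧ ∀ y ∈ I, y ≠ x → ¬ G.Adj y u} with hR
  have hRcl : ∀ x ∈ I, (R x).card ≤ d := by
    intro x hx
    apply hd
    intro u hu w hw huw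
    simp only [hR, Finset.coe_filter, Set.mem_ofPred_eq] at hu hw
    rcases hu with ⟨huS, rfl | ⟨hxu, hu⟩⟩ <;> rcases hw with ⟨hwS, rfl | ⟨hxw, hw⟩⟩
    · exact absurd rfl huw
    · exact hxw
    · exact hxu.symm
    by_contra hnadj
    have huI : u ∉ I := fun h => hind hx h hxu.ne hxu
    have hwI : w ∉ I := fun h => hind hx h hxw.ne hxw
    have hle := hmax (insert u (insert w (I.erase x)))
      (by
        rw [Finset.insert_subset_iff, Finset.insert_subset_iff]
        exact ⟨huS, hwS, (Finset.erase_subset _ _).trans hIS⟩)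
      (by
        have hsym : Std.Symm fun v w => ¬ G.Adj v w := ⟨fun _ _ h h' => h h'.symm⟩
        simp only [IsIndepSet, Finset.coe_insert]
        rw [Set.pairwise_insert_of_symm, Set.pairwise_insert_of_symm]
        refine ⟨⟨hind.mono (by simp), fun y hy _ h => ?_⟩, fun y hy _ h => ?_⟩
        · rw [Finset.mem_coe, Finset.mem_erase] at hy
          exact hw y hy.2 hy.1 h.symm
        · rw [Set.mem_insert_iff, Finset.mem_coe, Finset.mem_erase] at hy
          rcases hy with rfl | hy
          · exact hnadj h
          · exact hu y hy.2 hy.1 h.symm)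
    rw [Finset.card_insert_of_notMem (by simp [huw, huI]),
      Finset.card_insert_of_notMem (by simp [hwI]), Finset.card_erase_of_mem hx] at hle
    have := Finset.card_pos.2 ⟨x, hx⟩
    omega
  have hcover : S ⊆ I.biUnion R ∪
      I.offDiag.biUnion fun e => G.neighborFinset e.1 ∩ G.neighborFinset e.2 := by
    intro u hu
    rw [Finset.mem_union, Finset.mem_biUnion, Finset.mem_biUnion]
    by_cases huI : u ∈ I
    · exact Or.inl ⟨u, huI, by simp [hR, hu]⟩
    have hex : ∃ x ∈ I, G.Adj x u := by
      by_contra! hno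
      have := hmax (insert u I) (Finset.insert_subset hu hIS)
        (by
          have hsym : Std.Symm fun v w => ¬ G.Adj v w := ⟨fun _ _ h h' => h h'.symm⟩
          simp only [IsIndepSet, Finset.coe_insert]
          rw [Set.pairwise_insert_of_symm]
          exact ⟨hind, fun y hy _ h => hno y hy h.symm⟩)
      rw [Finset.card_insert_of_notMem huI] at this
      omega
    obtain ⟨x, hx, hxu⟩ := hex
    by_cases h2 : ∃ y ∈ I, y ≠ x ∧ G.Adj y u
    · obtain ⟨y, hy, hyx, hyu⟩ := h2
      exact Or.inr ⟨(x, y), Finset.mem_offDiag.2 ⟨hx, hy, hyx.symm⟩, by simp [hxu, hyu]⟩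
    · push Not at h2
      exact Or.inl ⟨x, hx, by simpa [hR, hu] using Or.inr ⟨hxu, h2⟩⟩
  have h1 : (I.biUnion R).card ≤ I.card * d := Finset.card_biUnion_le_card_mul _ _ _ hRcl
  have h2 : (I.offDiag.biUnion fun e => G.neighborFinset e.1 ∩ G.neighborFinset e.2).card ≤
      I.offDiag.card * d := by
    refine Finset.card_biUnion_le_card_mul _ _ _ fun e he => ?_
    obtain ⟨h1, h2, h3⟩ := Finset.mem_offDiag.1 he
    exact hco _ _ h3 (hind h1 h2 h3)
  have h3 : I.offDiag.card ≤ t ^ 2 := by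
    rw [Finset.offDiag_card]
    nlinarith [Nat.sub_le (I.card * I.card) I.card]
  calc S.card ≤ I.card * d + I.offDiag.card * d :=
        (Finset.card_le_card hcover).trans ((Finset.card_union_le _ _).trans (add_le_add h1 h2))
    _ ≤ t * d + t ^ 2 * d := by gcongr
    _ = _ := by ring

/-- The neighbours `u` of `v` for which the edge `uv` lies in at least `η deg v` triangles (up to a
rounding by one). -/
noncomputable def heavyNeighbors (G : SimpleGraph V) (η : ℝ) (v : V) : Finset V :=
  {u ∈ G.neighborFinset v |
    η * G.degree v < ((G.neighborFinset u ∩ G.neighborFinset v).card : ℝ) + 1}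

/-- Few neighbours of `v` are heavy: `2 / η` independent ones would together have more than `deg v`
neighbours among those of `v`. -/
theorem card_heavyNeighbors_le (hd : ∀ S : Finset V, G.IsClique S → S.card ≤ d)
    (hco : ∀ x y, x ≠ y → ¬ G.Adj x y → (G.neighborFinset x ∩ G.neighborFinset y).card ≤ d)
    {η : ℝ} (hη0 : 0 < η) (hη1 : η ≤ 1) {t : ℕ} (ht : 2 ≤ t * η) (v : V) :
    ((heavyNeighbors G η v).card : ℝ) ≤ η * G.degree v + (t + t ^ 2) / η * d := by
  have hcardN : (heavyNeighbors G η v).card ≤ G.degree v := by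
    rw [← card_neighborFinset_eq_degree]
    exact Finset.card_le_card (Finset.filter_subset _ _)
  have hK : (0 : ℝ) ≤ (t + t ^ 2) / η * d := by positivity
  by_cases hD : η * G.degree v ≤ (t + t ^ 2) * d
  · have h1 : ((heavyNeighbors G η v).card : ℝ) ≤ G.degree v := by exact_mod_cast hcardN
    have h2 : (G.degree v : ℝ) ≤ (t + t ^ 2) / η * d := by
      rw [div_mul_eq_mul_div, le_div_iff₀ hη0]
      linarith
    have : 0 ≤ η * G.degree v := by positivity
    linarith
  push Not at hD
  have hd1 : (1 : ℝ) ≤ d := by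
    have := hd {v} (by simp)
    exact_mod_cast this
  have hind : ∀ T ⊆ heavyNeighbors G η v, G.IsIndepSet T → T.card ≤ t := by
    intro T hT hTi
    by_contra! hlt
    obtain ⟨T', hT'T, hT'⟩ := Finset.exists_subset_card_eq hlt.le
    have hB := sum_card_le_card_biUnion_add T'
      (fun u => G.neighborFinset u ∩ G.neighborFinset v) d (fun x hx y hy hxy =>
        (Finset.card_le_card (Finset.inter_subset_inter Finset.inter_subset_left
          Finset.inter_subset_left)).trans (hco x y hxy (hTi (hT'T hx) (hT'T hy) hxy)))
    have hU : (T'.biUnion fun u => G.neighborFinset u ∩ G.neighborFinset v).card ≤ G.degree v := by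
      rw [← card_neighborFinset_eq_degree]
      exact Finset.card_le_card (Finset.biUnion_subset.2 fun u _ => Finset.inter_subset_right)
    have hlow : (t : ℝ) * (η * G.degree v - 1) ≤
        ∑ u ∈ T', ((G.neighborFinset u ∩ G.neighborFinset v).card : ℝ) := by
      rw [← hT', ← nsmul_eq_mul]
      refine Finset.card_nsmul_le_sum _ _ _ fun u hu => ?_
      linarith [(Finset.mem_filter.1 (hT (hT'T hu))).2]
    have hB' : (∑ u ∈ T', ((G.neighborFinset u ∩ G.neighborFinset v).card : ℝ)) ≤
        G.degree v + t ^ 2 * d := by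
      rw [hT'] at hB
      exact_mod_cast hB.trans (Nat.add_le_add_right hU _)
    have h1 : 2 * (G.degree v : ℝ) ≤ t * η * G.degree v := by gcongr
    have h2 : η * (G.degree v : ℝ) ≤ G.degree v := by
      have : (0 : ℝ) ≤ G.degree v := Nat.cast_nonneg _
      nlinarith
    have h3 : (t : ℝ) ≤ t * d := le_mul_of_one_le_right (Nat.cast_nonneg _) hd1
    nlinarith
  have := card_le_of_forall_isIndepSet hd hco _ hind
  have h' : ((heavyNeighbors G η v).card : ℝ) ≤ (t + t ^ 2) * d := by exact_mod_cast this
  linarith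

/-- A symmetric weight `a` has a set `U` all of whose elements `v` have weight at least `c v` to
`U`, such that the total weight in `U` is large: `U` maximizes that weight minus `2 ∑ c`. -/
theorem exists_finset_le_sum {ι : Type*} [Fintype ι] (a : ι → ι → ℝ) (hsymm : ∀ u v, a u v = a v u)
    (hdiag : ∀ v, a v v = 0) (c : ι → ℝ) (hc : ∀ v, 0 ≤ c v) :
    ∃ U : Finset ι, (∀ v ∈ U, c v ≤ ∑ w ∈ U, a v w) ∧
      ∑ v, ∑ w, a v w - 2 * ∑ v, c v ≤ ∑ v ∈ U, ∑ w ∈ U, a v w := by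
  obtain ⟨U, -, hU⟩ := Finset.exists_max_image Finset.univ
    (fun U : Finset ι => ∑ v ∈ U, ∑ w ∈ U, a v w - 2 * ∑ v ∈ U, c v) ⟨∅, Finset.mem_univ _⟩
  refine ⟨U, fun x hx => ?_, ?_⟩
  · have h := hU (U.erase x) (Finset.mem_univ _)
    have hs : ∀ f : ι → ℝ, ∑ w ∈ U, f w = f x + ∑ w ∈ U.erase x, f w := fun f =>
      (Finset.add_sum_erase U f hx).symm
    have h1 : ∑ v ∈ U, ∑ w ∈ U, a v w =
        2 * ∑ w ∈ U.erase x, a x w + ∑ v ∈ U.erase x, ∑ w ∈ U.erase x, a v w := by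
      rw [hs, hs, hdiag, Finset.sum_congr rfl fun v _ => hs (a v), Finset.sum_add_distrib,
        Finset.sum_congr rfl fun v _ => hsymm v x]
      ring
    rw [hs (a x), hdiag]
    rw [h1, hs c] at h
    linarith
  · have h := hU Finset.univ (Finset.mem_univ _)
    have := Finset.sum_nonneg fun v (_ : v ∈ U) => hc v
    linarith

/-- A subgraph `H` with almost all the edges of `G` in which, for every edge `uv`, few of the
neighbours of `v` are neighbours of `u` in `G`. -/
theorem exists_subgraph_few_triangles (hd : ∀ S : Finset V, G.IsClique S → S.card ≤ d)
    (hco : ∀ x y, x ≠ y → ¬ G.Adj x y → (G.neighborFinset x ∩ G.neighborFinset y).card ≤ d)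
    {θ : ℝ} (hθ0 : 0 < θ) (hθ1 : θ ≤ 1) {t : ℕ} (ht : 2 ≤ t * θ ^ 2) :
    ∃ H : SimpleGraph V, H ≤ G ∧ (∀ u v, H.Adj u v →
      (({w ∈ H.neighborFinset v | w = u ∨ G.Adj u w}.card : ℕ) : ℝ) ≤ θ * H.degree v) ∧
      (1 - 4 * θ) * ∑ v, (G.degree v : ℝ) -
        2 * (Fintype.card V * ((t + t ^ 2) / θ ^ 2 * d)) ≤ ∑ v, (H.degree v : ℝ) := by
  set S := heavyNeighbors G (θ ^ 2) with hS
  set K : ℝ := (t + t ^ 2) / θ ^ 2 * d with hK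
  have hSc : ∀ v, ((S v).card : ℝ) ≤ θ ^ 2 * G.degree v + K := fun v =>
    card_heavyNeighbors_le hd hco (by positivity) (by nlinarith) ht v
  set a : V → V → ℝ := fun u v => if G.Adj u v ∧ u ∉ S v ∧ v ∉ S u then 1 else 0 with ha
  obtain ⟨U, hU1, hU2⟩ := exists_finset_le_sum a
    (fun u v => by
      simp only [ha, G.adj_comm u v, and_comm (a := u ∉ S v)])
    (fun v => by simp [ha]) (fun v => θ * G.degree v) (fun v => by positivity)
  obtain ⟨H, hH⟩ : ∃ H : SimpleGraph V, ∀ u v, H.Adj u v ↔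
      (G.Adj u v ∧ u ∉ S v ∧ v ∉ S u) ∧ u ∈ U ∧ v ∈ U :=
    ⟨{ Adj := fun u v => (G.Adj u v ∧ u ∉ S v ∧ v ∉ S u) ∧ u ∈ U ∧ v ∈ U
       symm := ⟨fun u v h => ⟨⟨h.1.1.symm, h.1.2.2, h.1.2.1⟩, h.2.2, h.2.1⟩⟩
       loopless := ⟨fun v h => h.1.1.ne rfl⟩ }, fun _ _ => Iff.rfl⟩
  have hdegU : ∀ v ∈ U, (H.degree v : ℝ) = ∑ w ∈ U, a v w := by
    intro v hv
    rw [← card_neighborFinset_eq_degree, neighborFinset_eq_filter, ha]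
    simp only
    rw [Finset.sum_boole]
    congr 2
    ext w
    simp only [Finset.mem_filter, Finset.mem_univ, true_and, hH]
    tauto
  have hHG : H ≤ G := fun u v h => ((hH u v).1 h).1.1
  refine ⟨H, hHG, ?_, ?_⟩
  · intro u v hadj
    have huv := (hH u v).1 hadj
    have hnot : ¬ θ ^ 2 * G.degree v <
        ((G.neighborFinset u ∩ G.neighborFinset v).card : ℝ) + 1 := fun h =>
      huv.1.2.1 (Finset.mem_filter.2 ⟨(G.mem_neighborFinset v u).2 huv.1.1.symm, h⟩)
    have hsub : {w ∈ H.neighborFinset v | w = u ∨ G.Adj u w} ⊆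
        insert u (G.neighborFinset u ∩ G.neighborFinset v) := by
      intro w hw
      rw [Finset.mem_filter, mem_neighborFinset] at hw
      rw [Finset.mem_insert, Finset.mem_inter, mem_neighborFinset, mem_neighborFinset]
      exact hw.2.imp_right fun h => ⟨h, hHG hw.1⟩
    have h1 : (({w ∈ H.neighborFinset v | w = u ∨ G.Adj u w}.card : ℕ) : ℝ) ≤
        ((G.neighborFinset u ∩ G.neighborFinset v).card : ℝ) + 1 := by
      exact_mod_cast (Finset.card_le_card hsub).trans (Finset.card_insert_le _ _)
    have h2 := hU1 v huv.2.2
    rw [← hdegU v huv.2.2] at h2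
    nlinarith
  · have h1 : ∑ v, (H.degree v : ℝ) = ∑ v ∈ U, ∑ w ∈ U, a v w := by
      rw [← Finset.sum_subset (Finset.subset_univ U)]
      · exact Finset.sum_congr rfl hdegU
      · intro v _ hv
        rw [Nat.cast_eq_zero, ← card_neighborFinset_eq_degree, Finset.card_eq_zero,
          Finset.eq_empty_iff_forall_notMem]
        intro w hw
        exact hv ((hH v w).1 ((H.mem_neighborFinset v w).1 hw)).2.1
    have h2 : ∀ v w, (if G.Adj v w then (1 : ℝ) else 0) - (if w ∈ S v then 1 else 0) -
        (if v ∈ S w then 1 else 0) ≤ a v w := by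
      intro v w
      simp only [ha]
      by_cases c1 : G.Adj v w <;> by_cases c2 : w ∈ S v <;> by_cases c3 : v ∈ S w <;>
        simp [c1, c2, c3]
    have h3 := Finset.sum_le_sum fun v (_ : v ∈ Finset.univ) =>
      Finset.sum_le_sum fun w (_ : w ∈ Finset.univ) => h2 v w
    simp only [Finset.sum_sub_distrib] at h3
    have h4 : ∑ v, ∑ w, (if v ∈ S w then (1 : ℝ) else 0) = ∑ v, ((S v).card : ℝ) := by
      rw [Finset.sum_comm]
      simp
    have h5 : ∑ v, ∑ w, (if w ∈ S v then (1 : ℝ) else 0) = ∑ v, ((S v).card : ℝ) := by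
      simp
    have h6 : ∑ v, ∑ w, (if G.Adj v w then (1 : ℝ) else 0) = ∑ v, (G.degree v : ℝ) := by
      simp [← card_neighborFinset_eq_degree, neighborFinset_eq_filter]
    rw [h4, h5, h6] at h3
    have h7 := Finset.sum_le_sum fun v (_ : v ∈ Finset.univ) => hSc v
    rw [Finset.sum_add_distrib, ← Finset.mul_sum, Finset.sum_const, Finset.card_univ,
      nsmul_eq_mul] at h7
    rw [← Finset.mul_sum] at hU2
    have h8 : (0 : ℝ) ≤ ∑ v, (G.degree v : ℝ) := Finset.sum_nonneg fun v _ => Nat.cast_nonneg _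
    have h9 : θ ^ 2 * ∑ v, (G.degree v : ℝ) ≤ θ * ∑ v, (G.degree v : ℝ) :=
      mul_le_mul_of_nonneg_right (by nlinarith) h8
    rw [h1]
    linarith

/-- The degree sum is at most `n (X + O(d))`, up to a factor close to `1`, if each directed edge
together with its reverse has at most `2 X ^ r` extensions by `r` steps, in every subgraph. -/
theorem sum_degree_le [Nonempty V] (hd : ∀ S : Finset V, G.IsClique S → S.card ≤ d)
    (hco : ∀ x y, x ≠ y → ¬ G.Adj x y → (G.neighborFinset x ∩ G.neighborFinset y).card ≤ d)
    {θ : ℝ} (hθ0 : 0 < θ) (hθ : 2 * θ < 1) {t : ℕ} (ht : 2 ≤ t * θ ^ 2) {r : ℕ}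
    (hr : r ≠ 0) {X : ℝ} (hX : 0 < X) (hM : ∀ H ≤ G, ∀ u v, G.Adj u v →
      (numExtensions G H r u v + numExtensions G H r v u : ℝ) ≤ 2 * X ^ r) :
    (1 - 2 * θ) * ((1 - 4 * θ) * ∑ v, (G.degree v : ℝ)) ≤
      Fintype.card V * (X + 2 * ((t + t ^ 2) / θ ^ 2 * d)) := by
  obtain ⟨H, hHG, hrow, hsum⟩ := exists_subgraph_few_triangles hd hco hθ0 (by linarith) ht
  have hn : (0 : ℝ) < Fintype.card V := by exact_mod_cast Fintype.card_pos
  have hK : (0 : ℝ) ≤ Fintype.card V * ((t + t ^ 2) / θ ^ 2 * d) := by positivity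
  have hH : (1 - 2 * θ) * ∑ v, (H.degree v : ℝ) ≤ Fintype.card V * X := by
    have h0 : (0 : ℝ) ≤ ∑ v, (H.degree v : ℝ) := Finset.sum_nonneg fun v _ => Nat.cast_nonneg _
    rcases h0.eq_or_lt with h0 | h0
    · rw [← h0, mul_zero]
      positivity
    have ha : 0 < (∑ v, (H.degree v : ℝ)) / Fintype.card V := by positivity
    have h := pow_average_degree_le hθ0.le hθ hrow ha (div_mul_cancel₀ _ hn.ne').symm
      (pow_pos hX r) (fun u v huv => hM H hHG u v (hHG huv))
    have h' := (pow_le_pow_iff_left₀ (mul_pos (by linarith) ha).le hX.le hr).1 h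
    rw [← mul_div_assoc, div_le_iff₀ hn] at h'
    linarith
  have h1 := mul_le_mul_of_nonneg_left hsum (show 0 ≤ 1 - 2 * θ by linarith)
  nlinarith

end SimpleGraph

/-! ### The bound on the number of edges -/

namespace PreAbstractSimplicialComplex

variable {V : Type*} [DecidableEq V] [Fintype V] (k : Type*) [Field k]
  {Γ : PreAbstractSimplicialComplex V}

theorem shortCyclesHaveTriangles_skeletonGraph {g : ℕ} (hg : (g : ℕ∞) < Γ.girth k 1) :
    Γ.skeletonGraph.ShortCyclesHaveTriangles g := by
  intro P Q p q hp hq h0 h1 hP hQ hP0 hQ0 hne hpq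
  by_contra! hcon
  refine absurd (girth_one_le_of_walks k Γ (F := ∅) (Or.inl rfl) hp hq h0 h1
    (fun i hi => ⟨(hP i hi).1, (Γ.link_empty_faces _).2 (hP i hi).2⟩)
    (fun i hi => ⟨(hQ i hi).1, (Γ.link_empty_faces _).2 (hQ i hi).2⟩) hP0 hQ0 hne ?_)
    (not_le.2 (lt_of_le_of_lt (by exact_mod_cast hpq) hg))
  intro y hy hy0 hy1 hface
  rw [link_empty_faces] at hface
  exact hcon y hy (skeletonGraph_adj_of_mem hface (by simp) (by simp) hy0)
    (skeletonGraph_adj_of_mem hface (by simp) (by simp) hy1)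

theorem card_le_of_isClique {g d : ℕ} (hg : (g : ℕ∞) < Γ.girth k 1) (hg3 : 3 ≤ g) (hd1 : 1 ≤ d)
    (hdim : Γ.HasDimension ((d : ℤ) - 1)) {S : Finset V} (hS : Γ.skeletonGraph.IsClique S) :
    S.card ≤ d := by
  -- A vertex need not be a face, so cliques with at most one vertex are treated apart.
  rcases Nat.lt_or_ge S.card 2 with h | h
  · omega
  have hface := isFace_of_isClique k (lt_of_le_of_lt (by exact_mod_cast hg3) hg) S.card S rfl h hS
  have := hdim.2 ⟨S, Or.inr hface, rfl⟩
  omega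

open scoped Classical in
theorem two_mul_faceNumber_one_le (Γ : PreAbstractSimplicialComplex V) :
    2 * Γ.faceNumber 1 ≤ ∑ v, Γ.skeletonGraph.degree v := by
  rw [SimpleGraph.sum_degrees_eq_twice_card_edges]
  refine Nat.mul_le_mul_left 2 ?_
  calc Γ.faceNumber 1
      ≤ (↑(Γ.skeletonGraph.edgeFinset.image Sym2.toFinset) : Set (Finset V)).ncard := by
        refine Set.ncard_le_ncard ?_ (Finset.finite_toSet _)
        rintro F ⟨hF, hc⟩
        obtain ⟨x, y, hxy, rfl⟩ := Finset.card_eq_two.1 hc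
        rw [Finset.mem_coe, Finset.mem_image]
        refine ⟨s(x, y), by simpa using ⟨hxy, hF⟩, by ext; simp⟩
    _ ≤ _ := by
        rw [Set.ncard_coe_finset]
        exact Finset.card_image_le

theorem faceNumber_one_eq_zero {V : Type*} [Finite V] {Γ : PreAbstractSimplicialComplex V}
    (hdim : Γ.HasDimension (((1 : ℕ) : ℤ) - 1)) :
    Γ.faceNumber 1 = 0 := by
  rw [faceNumber, Set.ncard_eq_zero]
  ext F
  simp only [Set.mem_ofPred_eq, Set.mem_empty_iff_false, iff_false, not_and]
  intro hF hc
  have := hdim.2 ⟨F, Or.inr hF, rfl⟩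
  omega

/-- The bound on the number of edges, for a number `X` such that each edge has at most `2 X ^ r`
extensions by `r` steps in the two directions. -/
theorem faceNumber_one_le {g d t r : ℕ} (hr : 2 ≤ r) (hrg : 2 * r ≤ g)
    (hg : (g : ℕ∞) < Γ.girth k 1) (hd1 : 1 ≤ d) (hdim : Γ.HasDimension ((d : ℤ) - 1))
    [Nonempty V] {θ : ℝ} (hθ0 : 0 < θ) (hθ : 4 * θ < 1) (ht : 2 ≤ t * θ ^ 2) {X : ℝ} (hX : 0 < X)
    (hM : ∀ H ≤ Γ.skeletonGraph, ∀ u v, Γ.skeletonGraph.Adj u v →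
      (SimpleGraph.numExtensions Γ.skeletonGraph H r u v +
        SimpleGraph.numExtensions Γ.skeletonGraph H r v u : ℝ) ≤ 2 * X ^ r) :
    (1 - 6 * θ) * (2 * Γ.faceNumber 1) ≤
      Fintype.card V * (X + 2 * ((t + t ^ 2) / θ ^ 2 * d)) := by
  classical
  have hG := shortCyclesHaveTriangles_skeletonGraph k hg
  have hd : ∀ S : Finset V, Γ.skeletonGraph.IsClique S → S.card ≤ d := fun S hS =>
    card_le_of_isClique k hg (by omega) hd1 hdim hS
  have h := SimpleGraph.sum_degree_le hd
    (fun x y hxy hadj => SimpleGraph.card_inter_neighborFinset_le hG (by omega) hd hxy hadj)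
    hθ0 (by linarith) ht (by omega) hX hM
  have hf : (2 * Γ.faceNumber 1 : ℝ) ≤ ∑ v, (Γ.skeletonGraph.degree v : ℝ) := by
    have := two_mul_faceNumber_one_le Γ
    exact_mod_cast this
  refine le_trans ?_ h
  have hpos : (0 : ℝ) ≤ 2 * Γ.faceNumber 1 := by positivity
  calc (1 - 6 * θ) * (2 * Γ.faceNumber 1 : ℝ)
      ≤ (1 - 2 * θ) * (1 - 4 * θ) * (2 * Γ.faceNumber 1) := by
        refine mul_le_mul_of_nonneg_right ?_ hpos
        nlinarith
    _ ≤ (1 - 2 * θ) * (1 - 4 * θ) * ∑ v, (Γ.skeletonGraph.degree v : ℝ) :=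
        mul_le_mul_of_nonneg_left hf (mul_nonneg (by linarith) (by linarith))
    _ = _ := by ring

end PreAbstractSimplicialComplex

/-- `Y = (d - 1) ^ (1 - 1 / r) n ^ (1 / r)` satisfies `Y ^ r = n (d - 1) ^ (r - 1)`. -/
theorem rpow_mul_rpow_pow {x y : ℝ} (hx : 0 ≤ x) (hy : 0 ≤ y) {r : ℕ} (hr : 1 ≤ r) :
    (x ^ (1 - 1 / (r : ℝ)) * y ^ (1 / (r : ℝ))) ^ r = y * x ^ (r - 1) := by
  have hr0 : (r : ℝ) ≠ 0 := by positivity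
  rw [mul_pow, ← Real.rpow_mul_natCast hx, ← Real.rpow_mul_natCast hy,
    one_div_mul_cancel hr0, Real.rpow_one, sub_mul, one_div_mul_cancel hr0, one_mul,
    ← Nat.cast_pred hr, Real.rpow_natCast, mul_comm]

/-- If `r / log (n / d) < 1 / c` then `Y = (d - 1) ^ (1 - 1 / r) n ^ (1 / r)` is at least `d / 2`
times `exp c`. -/
theorem half_mul_exp_le {n d r : ℕ} {c : ℝ} (hc : 0 < c) (hd : 2 ≤ d) (hdn : d < n) (hr : 1 ≤ r)
    (h : (r : ℝ) / Real.log ((n : ℝ) / d) < 1 / c) :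
    (d : ℝ) / 2 * Real.exp c ≤ ((d : ℝ) - 1) ^ (1 - 1 / (r : ℝ)) * (n : ℝ) ^ (1 / (r : ℝ)) := by
  have hd' : (2 : ℝ) ≤ d := by exact_mod_cast hd
  have hnd : (d : ℝ) < n := by exact_mod_cast hdn
  have hlog : 0 < Real.log ((n : ℝ) / d) := Real.log_pos ((one_lt_div (by linarith)).2 hnd)
  have hexp : Real.exp c ^ r ≤ (n : ℝ) / d := by
    rw [← Real.exp_nat_mul, ← Real.le_log_iff_exp_le (div_pos (by linarith) (by linarith))]
    rw [div_lt_div_iff₀ hlog hc] at h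
    linarith
  have hY : 0 ≤ ((d : ℝ) - 1) ^ (1 - 1 / (r : ℝ)) * (n : ℝ) ^ (1 / (r : ℝ)) :=
    mul_nonneg (Real.rpow_nonneg (by linarith) _) (by positivity)
  rw [← pow_le_pow_iff_left₀ (by positivity) hY (by omega : r ≠ 0),
    rpow_mul_rpow_pow (by linarith) (by positivity) hr, mul_pow]
  obtain ⟨s, rfl⟩ : ∃ s, r = s + 1 := ⟨r - 1, by omega⟩
  rw [Nat.add_sub_cancel, pow_succ ((d : ℝ) / 2)]
  calc ((d : ℝ) / 2) ^ s * (d / 2) * Real.exp c ^ (s + 1)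
      ≤ ((d : ℝ) - 1) ^ s * d * ((n : ℝ) / d) := by
        have : 0 ≤ (d : ℝ) - 1 := by linarith
        gcongr <;> linarith
    _ = n * ((d : ℝ) - 1) ^ s := by
        field_simp

/-- The passage from the bound with error terms to the final form, for the leading constant
`b / 2`. -/
theorem le_of_error_bound {f n d Y K ε θ b B : ℝ} (hε : 0 < ε) (hn : 0 ≤ n) (hY : 0 ≤ Y)
    (hθ : 6 * θ * (1 + ε) ≤ ε) (hb1 : b ≤ 1) (hBb : b / 2 = B) (hf : 0 ≤ f)
    (hKY : 2 * (1 + ε) * (K * d) ≤ ε * Y)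
    (h : (1 - 6 * θ) * (2 * f) ≤ n * (b * Y + 2 * (K * d))) :
    f ≤ (B + ε) * (Y * n) := by
  have h1 : 2 * f ≤ (1 + ε) * (n * (b * Y + 2 * (K * d))) := by
    nlinarith [mul_le_mul_of_nonneg_left h (by linarith : 0 ≤ 1 + ε)]
  have h2 : n * (2 * (1 + ε) * (K * d)) ≤ n * (ε * Y) := mul_le_mul_of_nonneg_left hKY hn
  have h3 : ε * b * (n * Y) ≤ ε * 1 * (n * Y) := by gcongr
  subst hBb
  nlinarith

theorem mainTheorem1 (ε : ℝ) (hε : 0 < ε) :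
    ∃ δ : ℝ, 0 < δ ∧
      ∀ (k : Type*) [Field k] (V : Type*) [Fintype V] [DecidableEq V]
        (Γ : PreAbstractSimplicialComplex V) (n d r : ℕ),
        Fintype.card V = n →
        Γ.HasDimension ((d : ℤ) - 1) →
        1 ≤ d → d < n → 2 ≤ r →
        (r : ℝ) / Real.log ((n : ℝ) / (d : ℝ)) < δ →
        (((2 * r : ℕ) : ℕ∞) < Γ.girth k 1 →
          (Γ.faceNumber 1 : ℝ) ≤
            ((2 : ℝ)⁻¹ + ε) * ((d : ℝ) - 1) ^ (1 - 1 / (r : ℝ)) * (n : ℝ) ^ (1 + 1 / (r : ℝ))) ∧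
        (((2 * r + 1 : ℕ) : ℕ∞) < Γ.girth k 1 →
          (Γ.faceNumber 1 : ℝ) ≤
            ((2 : ℝ) ^ (-1 - 1 / (r : ℝ)) + ε) * ((d : ℝ) - 1) ^ (1 - 1 / (r : ℝ)) *
              (n : ℝ) ^ (1 + 1 / (r : ℝ))) := by
  -- `1 - 6 θ ≥ 1 / (1 + ε)`
  set θ : ℝ := ε / (6 * (1 + ε)) with hθ
  have hθ0 : 0 < θ := by positivity
  have hθε : 6 * θ * (1 + ε) = ε := by rw [hθ]; field_simp
  have hθ6 : 6 * θ < 1 := by nlinarith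
  obtain ⟨t, ht⟩ := exists_nat_ge (2 / θ ^ 2)
  have ht : 2 ≤ t * θ ^ 2 := by rwa [div_le_iff₀ (by positivity)] at ht
  set K : ℝ := (t + t ^ 2) / θ ^ 2 with hK
  have hK0 : 0 ≤ K := by positivity
  -- `exp c` outweighs the constant in the error term `O(d)`.
  set c : ℝ := 4 * (1 + ε) * K / ε + 1 with hc
  have hc0 : 0 < c := by positivity
  refine ⟨1 / c, by positivity, ?_⟩
  intro k _ V _ _ Γ n d r hn hdim hd1 hdn hr hlog
  have hn0 : (0 : ℝ) < n := by exact_mod_cast (by omega : 0 < n)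
  rcases (by omega : d = 1 ∨ 2 ≤ d) with rfl | hd2
  · rw [PreAbstractSimplicialComplex.faceNumber_one_eq_zero hdim]
    simp only [Nat.cast_zero, Nat.cast_one, sub_self]
    exact ⟨fun _ => by positivity, fun _ => by positivity⟩
  have hV : Nonempty V := Fintype.card_pos_iff.1 (by omega)
  have hd' : (0 : ℝ) < (d : ℝ) - 1 := by
    have : (2 : ℝ) ≤ d := by exact_mod_cast hd2
    linarith
  set Y : ℝ := ((d : ℝ) - 1) ^ (1 - 1 / (r : ℝ)) * (n : ℝ) ^ (1 / (r : ℝ)) with hY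
  have hY0 : 0 < Y := mul_pos (Real.rpow_pos_of_pos hd' _) (Real.rpow_pos_of_pos hn0 _)
  have hYr : Y ^ r = (n * (d - 1) ^ (r - 1) : ℕ) := by
    rw [hY, rpow_mul_rpow_pow hd'.le hn0.le (by omega)]
    push_cast [Nat.cast_pred hd1]
    rfl
  have hKY : 2 * (1 + ε) * (K * d) ≤ ε * Y := by
    have h1 := half_mul_exp_le hc0 hd2 hdn (by omega) hlog
    have h2 := Real.add_one_le_exp c
    have h3 : ε * c = 4 * (1 + ε) * K + ε := by rw [hc]; field_simp
    have h4 : (d : ℝ) / 2 * c ≤ Y := le_trans (by gcongr; linarith) h1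
    have h5 := mul_le_mul_of_nonneg_left h4 hε.le
    have h6 : (0 : ℝ) ≤ d * ε := by positivity
    nlinarith
  have hYn : ∀ A : ℝ, A * ((d : ℝ) - 1) ^ (1 - 1 / (r : ℝ)) * (n : ℝ) ^ (1 + 1 / (r : ℝ)) =
      A * (Y * n) := by
    intro A
    rw [hY, Real.rpow_add hn0, Real.rpow_one]
    ring
  constructor
  · intro hg
    have hG := PreAbstractSimplicialComplex.shortCyclesHaveTriangles_skeletonGraph k hg
    have hM : ∀ H ≤ Γ.skeletonGraph, ∀ u v, Γ.skeletonGraph.Adj u v →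
        (SimpleGraph.numExtensions Γ.skeletonGraph H r u v +
          SimpleGraph.numExtensions Γ.skeletonGraph H r v u : ℝ) ≤ 2 * Y ^ r := by
      intro H hH u v _
      have hb : ∀ x y, (SimpleGraph.numExtensions Γ.skeletonGraph H r x y : ℝ) ≤ Y ^ r := by
        intro x y
        rw [hYr, ← hn]
        exact_mod_cast SimpleGraph.numExtensions_le hH hG (fun S hS =>
          PreAbstractSimplicialComplex.card_le_of_isClique k hg (by omega) hd1 hdim hS)
          (by omega) le_rfl x y
      linarith [hb u v, hb v u]
    have h := PreAbstractSimplicialComplex.faceNumber_one_le k hr le_rfl hg hd1 hdim hθ0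
      (by linarith) ht hY0 hM
    rw [hYn]
    refine le_of_error_bound hε hn0.le hY0.le hθε.le (b := 1) le_rfl (by norm_num)
      (Nat.cast_nonneg _) hKY ?_
    rwa [one_mul, ← hn]
  · intro hg
    have hG := PreAbstractSimplicialComplex.shortCyclesHaveTriangles_skeletonGraph k hg
    set b : ℝ := (2 : ℝ) ^ (-(1 / (r : ℝ))) with hb
    have hb0 : 0 < b := by positivity
    have hbr : b ^ r = 1 / 2 := by
      rw [hb, ← Real.rpow_mul_natCast (by norm_num), neg_mul, one_div_mul_cancel (by positivity),
        Real.rpow_neg_one, one_div]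
    have hM : ∀ H ≤ Γ.skeletonGraph, ∀ u v, Γ.skeletonGraph.Adj u v →
        (SimpleGraph.numExtensions Γ.skeletonGraph H r u v +
          SimpleGraph.numExtensions Γ.skeletonGraph H r v u : ℝ) ≤ 2 * (b * Y) ^ r := by
      intro H hH u v huv
      rw [mul_pow, hbr, hYr, ← hn, ← mul_assoc, mul_one_div_cancel two_ne_zero, one_mul]
      exact_mod_cast SimpleGraph.numExtensions_add_numExtensions_le hH hG (fun S hS =>
        PreAbstractSimplicialComplex.card_le_of_isClique k hg (by omega) hd1 hdim hS)
        (by omega) le_rfl huv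
    have h := PreAbstractSimplicialComplex.faceNumber_one_le k hr (by omega) hg hd1 hdim hθ0
      (by linarith) ht (mul_pos hb0 hY0) hM
    rw [hYn]
    refine le_of_error_bound hε hn0.le hY0.le hθε.le (b := b) ?_ ?_
      (Nat.cast_nonneg _) hKY ?_
    · exact Real.rpow_le_one_of_one_le_of_nonpos (by norm_num) (by
        rw [neg_nonpos]; positivity)
    · rw [hb, sub_eq_add_neg, Real.rpow_add two_pos, Real.rpow_neg_one]
      ring
    · rwa [← hn]
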